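/- Let $k \ge 1$ be an integer and let $\theta = 2\pi/(4k+5)$. Let $P$ be a finite set of points in the Euclidean plane and let $S$ be a planar set of constraints, i.e. a set of line segments with both endpoints in $P$, no two of which intersect properly. Two distinct points $u, v \in P$ *can see each other* if the segment $uv$ is a constraint or does not properly intersect any constraint. Around each $u \in P$ consider $4k+5$ rays with angle $\theta$ between consecutive rays; consecutive rays bound the cones $C_0^u, \dots, C_{4k+4}^u$, numbered clockwise, where the bisector of $C_0^u$ is the vertical halfline above $u$. Assume general position: no two points of $P$ lie on a line parallel to one of the rays that define the cones or on a line perpendicular to the bisector of a cone, and no three points of $P$ are collinear. The constraints that have $u$ as an endpoint and whose other endpoint lies in $C_i^u$ split $C_i^u$ into closed subcones (so that the other endpoint of such a constraint lies in both adjacent subcones; an unsplit cone is a single subcone). The *constrained $\theta_{4k+5}$-graph* is the undirected graph on $P$ that has, for each $u \in P$ and each subcone of each cone $C_i^u$ that contains a point other than $u$ that can see $u$, an edge from $u$ to the closest such point, where the distance of a point to $u$ is the distance from $u$ to its orthogonal projection on the bisector of the whole cone $C_i^u$. The length of a path is the sum of the Euclidean lengths of its edges. **Theorem.** Let $u, w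 \in P$ be two distinct vertices that can see each other and let $C_i^u$ be the cone of $u$ that contains $w$. Let $m$ be the midpoint of the side opposite $u$ of the canonical triangle of $u$ and $w$ (the triangle bounded by the two boundary rays of $C_i^u$ and the line through $w$ perpendicular to the bisector of $C_i^u$), and let $\alpha$ be the unsigned angle between $uw$ and $um$. Then there exists a path connecting $u$ and $w$ in the constrained $\theta_{4k+5}$-graph of length at most \[ \left( \frac{\cos \alpha}{\cos \left(\frac{\theta}{2}\right)} + \frac{\left( \cos \alpha \cdot \tan \left(\frac{\theta}{2}\right) + \sin \alpha \right) \cdot \cos \left(\frac{\theta}{4}\right)}{\cos \left(\frac{\theta}{2}\right) - \sin \left(\frac{3\theta}{4}\right)} \right) \cdot |uw| . \] -/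

import Mathlib

noncomputable section

namespace ConstrainedTheta

/-- The Euclidean plane; coordinate `0` is horizontal and coordinate `1` is vertical. -/
abbrev Plane : Type := EuclideanSpace ℝ (Fin 2)

/-- The unit vector at clockwise angle `φ` from the upward vertical direction. -/
def dir (φ : ℝ) : Plane := !₂[Real.sin φ, Real.cos φ]

/-- The aperture `θ = 2π / n` of a cone, when there are `n` cones around each vertex. -/
def theta (n : ℕ) : ℝ := 2 * Real.pi / n

/-- The direction of the bisector of the `i`-th cone. The bisector of cone `0` points vertically
upwards and the cones are numbered clockwise. -/
def bisector (n : ℕ) (i : Fin n) : Plane := dir ((i : ℝ) * theta n)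

/-- The direction of the ray bounding the `i`-th cone on its counterclockwise (left) side. -/
def leftRay (n : ℕ) (i : Fin n) : Plane := dir (((i : ℝ) - 1 / 2) * theta n)

/-- The direction of the ray bounding the `i`-th cone on its clockwise (right) side. -/
def rightRay (n : ℕ) (i : Fin n) : Plane := dir (((i : ℝ) + 1 / 2) * theta n)

/-- The closed region between the two rays from `u` with directions `d` and `e`. -/
def sector (u d e : Plane) : Set Plane :=
  {p | ∃ s t : ℝ, 0 ≤ s ∧ 0 ≤ t ∧ p = u + s • d + t • e}

/-- The region strictly between the two rays from `u` with directions `d` and `e`. -/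
def openSector (u d e : Plane) : Set Plane :=
  {p | ∃ s t : ℝ, 0 < s ∧ 0 < t ∧ p = u + s • d + t • e}

/-- The `i`-th cone `C_i^u` with apex `u`. -/
def cone (n : ℕ) (u : Plane) (i : Fin n) : Set Plane :=
  sector u (leftRay n i) (rightRay n i)

/-- General position of a point set with respect to `n` cones: no two points lie on a line parallel
to one of the rays that define the cones, no two points lie on a line perpendicular to the bisector
of a cone, and no three points are collinear. -/
structure GeneralPosition (n : ℕ) (P : Finset Plane) : Prop where
  not_parallel_ray : ∀ p ∈ P, ∀ q ∈ P, p ≠ q → ∀ (i : Fin n) (t : ℝ), q - p ≠ t • leftRay n i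
  not_perp_bisector : ∀ p ∈ P, ∀ q ∈ P, p ≠ q → ∀ i : Fin n, inner ℝ (q - p) (bisector n i) ≠ 0
  not_collinear : ∀ p ∈ P, ∀ q ∈ P, ∀ r ∈ P, p ≠ q → q ≠ r → p ≠ r →
    ¬ Collinear ℝ ({p, q, r} : Set Plane)

/-- A set of constraints, i.e. of line segments between two vertices of `P`, is given as a simple
graph on `P`. It is planar if no two different constraints intersect properly, i.e. in a point that
is interior to both. -/
def PlanarConstraints {P : Finset Plane} (S : SimpleGraph P) : Prop :=
  ∀ a b c d : P, S.Adj a b → S.Adj c d → s(a, b) ≠ s(c, d) →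
    Disjoint (openSegment ℝ (a : Plane) (b : Plane)) (openSegment ℝ (c : Plane) (d : Plane))

/-- The visibility graph `Vis(P, S)`: two different vertices see each other if the segment between
them is a constraint or does not properly intersect any constraint. -/
def vis {P : Finset Plane} (S : SimpleGraph P) : SimpleGraph P where
  Adj u v := u ≠ v ∧ (S.Adj u v ∨ ∀ a b : P, S.Adj a b →
    Disjoint (openSegment ℝ (u : Plane) (v : Plane)) (openSegment ℝ (a : Plane) (b : Plane)))
  symm := ⟨by
    rintro u v ⟨h, h'⟩
    refine ⟨h.symm, ?_⟩
    rw [openSegment_symm ℝ (v : Plane) (u : Plane), S.adj_comm v u]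
    exact h'⟩
  loopless := ⟨fun _ h => h.1 rfl⟩

/-- The directions of the rays from `u` that bound the subcones of `C_i^u`: the two bounding rays of
the cone, and the rays through the constraints from `u` whose other endpoint lies in the cone. -/
def splitDirs (n : ℕ) {P : Finset Plane} (S : SimpleGraph P) (u : P) (i : Fin n) : Set Plane :=
  {leftRay n i, rightRay n i} ∪
    {d | ∃ v : P, S.Adj u v ∧ (v : Plane) ∈ cone n u i ∧ d = (v : Plane) - (u : Plane)}

/-- `C` is a subcone of `C_i^u`: the closed region between two consecutive bounding rays. In
particular the endpoint of a constraint that splits the cone lies in both adjacent subcones, and a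
cone that is not split is its own single subcone. -/
def IsSubcone (n : ℕ) {P : Finset Plane} (S : SimpleGraph P) (u : P) (i : Fin n)
    (C : Set Plane) : Prop :=
  ∃ d ∈ splitDirs n S u i, ∃ e ∈ splitDirs n S u i, d ≠ e ∧
    (∀ f ∈ splitDirs n S u i, (u : Plane) + f ∉ openSector (u : Plane) d e) ∧
    C = sector (u : Plane) d e

/-- The orthogonal projection of `v` on the (line through the) bisector of `C_i^u`. -/
def bisectorProj (n : ℕ) (u : Plane) (i : Fin n) (v : Plane) : Plane :=
  u + (inner ℝ (v - u) (bisector n i) : ℝ) • bisector n i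

/-- `u` adds an edge to `v`: in some subcone of `u`, `v` is a vertex visible from `u` that is closest
to `u`, measured along the bisector of the original cone. -/
def AddsEdge (n : ℕ) {P : Finset Plane} (S : SimpleGraph P) (u v : P) : Prop :=
  (vis S).Adj u v ∧ ∃ (i : Fin n) (C : Set Plane), IsSubcone n S u i C ∧ (v : Plane) ∈ C ∧
    ∀ w : P, (vis S).Adj u w → (w : Plane) ∈ C →
      dist (u : Plane) (bisectorProj n u i v) ≤ dist (u : Plane) (bisectorProj n u i w)

/-- The constrained `θ_n`-graph of the vertex set `P` with constraints `S`. -/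
def thetaGraph (n : ℕ) {P : Finset Plane} (S : SimpleGraph P) : SimpleGraph P where
  Adj u v := AddsEdge n S u v ∨ AddsEdge n S v u
  symm := ⟨fun _ _ h => h.symm⟩
  loopless := ⟨fun _ h => h.elim (fun h => h.1.1 rfl) (fun h => h.1.1 rfl)⟩

/-- The Euclidean length of a walk in a graph whose vertices are points of the plane. -/
def walkLength {P : Finset Plane} {G : SimpleGraph P} {u w : P} (p : G.Walk u w) : ℝ :=
  (p.darts.map fun e => dist (e.fst : Plane) (e.snd : Plane)).sum

/-- The point where the ray from `u` with direction `r` meets the line through `w` perpendicular to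
the bisector of the `i`-th cone. -/
def corner (n : ℕ) (u w : Plane) (i : Fin n) (r : Plane) : Plane :=
  u + ((inner ℝ (w - u) (bisector n i) : ℝ) / (inner ℝ r (bisector n i) : ℝ)) • r

/-- For `w` in `C_i^u`, the midpoint of the side opposite `u` of the canonical triangle of `u` and
`w`, i.e. of the triangle bounded by the two borders of `C_i^u` and the line through `w`
perpendicular to the bisector of `C_i^u`. -/
def canonicalMidpoint (n : ℕ) (u w : Plane) (i : Fin n) : Plane :=
  midpoint ℝ (corner n u w i (leftRay n i)) (corner n u w i (rightRay n i))

end ConstrainedTheta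

end

open Set

namespace ConstrainedTheta

/-! Measure a vector `d` in the frame of cone `i` by its component `V` along the bisector and its
component `H` across it, and give it the weight `A * V + c * |H|`, with `c` the `horFactor` of θ and
`A = 1 / cos (θ/2) + c * tan (θ/2)` its `vertFactor`. Since `V = |uw| cos α` and `|H| = |uw| sin α`,
the claimed bound is exactly the weight of `w - u`. The proof is by induction on this weight over
the finitely many triples of two vertices and a cone.

Let `v` be the closest visible vertex in a subcone of `u` that contains `w`. The edge `uv` is in the
graph and has length at most `V(v) / cos (θ/2)`. If `v ≠ w`, wrap the vertices other than `u` in the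
triangle `uvw` by the convex chain from `v` to `w` that faces `u`. Its edges are visibility edges
(`exists_chain_successor`), and `v` is the lowest vertex of the triangle, so the chain ascends. By
convexity it goes first away from the side of `v` and then back. Hence its vertical parts telescope
and its horizontal variation is at most `|H(w)|` plus the offset of `v`, which is at most `tan (θ/2)
* V(v)` (`exists_walk_along_chain`). The term `c * tan (θ/2)` in `A` pays for this offset, and `1 /
cos (θ/2)` pays for the edge `uv`. What remains for the chain is strictly less than the weight of `w
- u`, so the induction applies to each of its edges.

The induction bounds a chain edge by its weight in the cone that contains it, whereas the sum above
uses the frame of cone `i`. Passing from cone `i` to that cone must not increase the weight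
(`exists_cone_weight_le`). This fixes `c`: the weight `A cos φ + c sin φ` of a unit vector at angle
`φ` is symmetric about its peak, and `c` puts the peak at π/4 + θ/8, so that the angles θ/4 and π/2
weigh the same. With `4k+5` cones, π/2 = (k+1)θ + θ/4, so a horizontal edge is at angle θ/4 from the
nearest bisector, which is the tight case. -/

/-! ### Plane geometry: determinants, coordinates with respect to a triangle, exits of segments -/

theorem plane_ext {p q : Plane} (h0 : p 0 = q 0) (h1 : p 1 = q 1) : p = q := by
  ext i
  fin_cases i
  · exact h0
  · exact h1

/-- The determinant of two vectors of the plane. -/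
def cross (p q : Plane) : ℝ := p 0 * q 1 - p 1 * q 0

/-- The closed triangle with corners `u`, `v` and `w`. -/
def triangle (u v w : Plane) : Set Plane :=
  {z | ∃ s t : ℝ, 0 ≤ s ∧ 0 ≤ t ∧ s + t ≤ 1 ∧ z = u + s • (v - u) + t • (w - u)}

/-- Cramer's rule. -/
theorem exists_coords {u v w : Plane} (h : cross (v - u) (w - u) ≠ 0) (a : Plane) :
    ∃ s t : ℝ, a = u + s • (v - u) + t • (w - u) := by
  refine ⟨cross (a - u) (w - u) / cross (v - u) (w - u),
    cross (v - u) (a - u) / cross (v - u) (w - u), plane_ext ?_ ?_⟩ <;>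
  · simp only [PiLp.add_apply, PiLp.smul_apply, PiLp.sub_apply, smul_eq_mul]
    field_simp
    simp only [cross, PiLp.sub_apply]
    ring

theorem coords_unique {u v w : Plane} (h : cross (v - u) (w - u) ≠ 0) {s t s' t' : ℝ}
    (e : u + s • (v - u) + t • (w - u) = u + s' • (v - u) + t' • (w - u)) :
    s = s' ∧ t = t' := by
  have e0 := congrArg (fun p : Plane => p 0) e
  have e1 := congrArg (fun p : Plane => p 1) e
  simp only [PiLp.add_apply, PiLp.smul_apply, PiLp.sub_apply, smul_eq_mul] at e0 e1
  simp only [cross, PiLp.sub_apply] at h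
  constructor
  · apply mul_right_cancel₀ h
    linear_combination (w 1 - u 1) * e0 - (w 0 - u 0) * e1
  · apply mul_right_cancel₀ h
    linear_combination (v 0 - u 0) * e1 - (v 1 - u 1) * e0

theorem mem_openSegment_iff {a b x : Plane} :
    x ∈ openSegment ℝ a b ↔ ∃ t : ℝ, 0 < t ∧ t < 1 ∧ x = a + t • (b - a) := by
  rw [openSegment_eq_image']
  constructor
  · rintro ⟨t, ⟨h0, h1⟩, rfl⟩
    exact ⟨t, h0, h1, rfl⟩
  · rintro ⟨t, h0, h1, rfl⟩
    exact ⟨t, ⟨h0, h1⟩, rfl⟩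

/-- Moving from a point of an open segment towards an end, but not as far as that end, one stays in
the open segment. -/
theorem mem_openSegment_of_partway {a b x : Plane} (hx : x ∈ openSegment ℝ a b) {r : ℝ}
    (h0 : 0 ≤ r) (h1 : r < 1) : x + r • (a - x) ∈ openSegment ℝ a b := by
  obtain ⟨t, ht0, ht1, rfl⟩ := mem_openSegment_iff.1 hx
  refine mem_openSegment_iff.2 ⟨t * (1 - r), mul_pos ht0 (by linarith), by nlinarith, ?_⟩
  module

theorem cross_eq_zero_of_mem_openSegment {a b x : Plane} (hx : x ∈ openSegment ℝ a b) :
    cross (b - a) (x - a) = 0 := by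
  obtain ⟨t, -, -, rfl⟩ := mem_openSegment_iff.1 hx
  simp only [cross, PiLp.add_apply, PiLp.smul_apply, PiLp.sub_apply, smul_eq_mul]
  ring

theorem collinear_of_cross_eq_zero {p q r : Plane} (hpq : p ≠ q)
    (h : cross (q - p) (r - p) = 0) : Collinear ℝ ({p, q, r} : Set Plane) := by
  rw [collinear_iff_of_mem (p₀ := p) (by simp)]
  refine ⟨q - p, ?_⟩
  simp only [cross, PiLp.sub_apply] at h
  have key : ∃ t : ℝ, r = t • (q - p) + p := by
    by_cases h0 : q 0 - p 0 = 0
    · have h1 : q 1 - p 1 ≠ 0 := fun h1 => hpq (plane_ext (by linarith) (by linarith))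
      refine ⟨(r 1 - p 1) / (q 1 - p 1), plane_ext ?_ ?_⟩
      · simp only [PiLp.add_apply, PiLp.smul_apply, PiLp.sub_apply, smul_eq_mul]
        have : (q 1 - p 1) * (r 0 - p 0) = 0 := by rw [h0] at h; linarith
        rcases mul_eq_zero.1 this with h' | h'
        · exact absurd h' h1
        · rw [h0]; linarith
      · simp only [PiLp.add_apply, PiLp.smul_apply, PiLp.sub_apply, smul_eq_mul]
        field_simp
        ring
    · refine ⟨(r 0 - p 0) / (q 0 - p 0), plane_ext ?_ ?_⟩
      · simp only [PiLp.add_apply, PiLp.smul_apply, PiLp.sub_apply, smul_eq_mul]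
        field_simp
        ring
      · simp only [PiLp.add_apply, PiLp.smul_apply, PiLp.sub_apply, smul_eq_mul]
        field_simp
        linarith
  obtain ⟨t, ht⟩ := key
  rintro x (rfl | rfl | rfl)
  · exact ⟨0, by simp⟩
  · exact ⟨1, by simp⟩
  · exact ⟨t, by simpa using ht⟩

theorem GeneralPosition.cross_ne_zero {n : ℕ} {P : Finset Plane} (hP : GeneralPosition n P)
    {p q r : P} (hpq : p ≠ q) (hqr : q ≠ r) (hpr : p ≠ r) :
    cross ((q : Plane) - p) ((r : Plane) - p) ≠ 0 := fun h =>
  hP.not_collinear p p.2 q q.2 r r.2 (Subtype.coe_injective.ne hpq) (Subtype.coe_injective.ne hqr)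
    (Subtype.coe_injective.ne hpr)
    (collinear_of_cross_eq_zero (Subtype.coe_injective.ne hpq) h)

theorem GeneralPosition.notMem_openSegment {n : ℕ} {P : Finset Plane} (hP : GeneralPosition n P)
    {a b u : P} (hab : a ≠ b) (ha : a ≠ u) (hb : b ≠ u) :
    (u : Plane) ∉ openSegment ℝ (a : Plane) (b : Plane) := fun h =>
  hP.cross_ne_zero hab hb ha (cross_eq_zero_of_mem_openSegment h)

/-- A segment that leaves a triangle does so through a side. -/
theorem exists_exit_of_notMem_triangle {u v w x a : Plane} (h : cross (v - u) (w - u) ≠ 0)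
    (hx : x ∈ triangle u v w) (ha : a ∉ triangle u v w) :
    ∃ r s t : ℝ, 0 ≤ r ∧ r < 1 ∧ 0 ≤ s ∧ 0 ≤ t ∧ s + t ≤ 1 ∧ (s = 0 ∨ t = 0 ∨ s + t = 1) ∧
      x + r • (a - x) = u + s • (v - u) + t • (w - u) := by
  obtain ⟨s₀, t₀, hs₀, ht₀, hst₀, rfl⟩ := hx
  obtain ⟨s₁, t₁, rfl⟩ := exists_coords h a
  -- The least of the three barycentric coordinates along the segment. It is nonnegative exactly
  -- inside the triangle, so the intermediate value theorem yields a point where it vanishes.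
  set f : ℝ → ℝ := fun r => min (min (s₀ + r * (s₁ - s₀)) (t₀ + r * (t₁ - t₀)))
    (1 - (s₀ + r * (s₁ - s₀)) - (t₀ + r * (t₁ - t₀))) with hf
  have hcont : ContinuousOn f (Icc 0 1) := by
    apply Continuous.continuousOn
    fun_prop
  have h0 : 0 ≤ f 0 := by
    simp only [hf, le_min_iff]
    refine ⟨⟨?_, ?_⟩, ?_⟩ <;> linarith
  have h1 : f 1 < 0 := by
    by_contra! hcon
    simp only [hf, le_min_iff] at hcon
    obtain ⟨⟨e1, e2⟩, e3⟩ := hcon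
    exact ha ⟨s₁, t₁, by linarith, by linarith, by linarith, rfl⟩
  obtain ⟨r, ⟨hr0, hr1⟩, hr⟩ := intermediate_value_Icc' zero_le_one hcont ⟨h1.le, h0⟩
  have hr1' : r < 1 := lt_of_le_of_ne hr1 (by rintro rfl; linarith)
  have hnn : 0 ≤ f r := hr.ge
  simp only [hf, le_min_iff] at hnn
  refine ⟨r, s₀ + r * (s₁ - s₀), t₀ + r * (t₁ - t₀), hr0, hr1', hnn.1.1, hnn.1.2, by linarith,
    ?_, by module⟩
  rcases min_choice (min (s₀ + r * (s₁ - s₀)) (t₀ + r * (t₁ - t₀)))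
    (1 - (s₀ + r * (s₁ - s₀)) - (t₀ + r * (t₁ - t₀))) with h' | h'
  · rcases min_choice (s₀ + r * (s₁ - s₀)) (t₀ + r * (t₁ - t₀)) with h'' | h''
    · left; rw [← h'', ← h']; exact hr
    · right; left; rw [← h'', ← h']; exact hr
  · right; right
    have : (1 - (s₀ + r * (s₁ - s₀)) - (t₀ + r * (t₁ - t₀))) = 0 := by rw [← h']; exact hr
    linarith

/-- A segment that starts inside a side of a triangle and runs into the triangle and out of it
again leaves through one of the other two sides. -/
theorem exists_exit_of_start_mem_side {s₀ s₁ t₁ : ℝ} (hs0 : 0 < s₀) (hs1 : s₀ < 1)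
    (hst : s₁ + t₁ < 1) (hneg : s₁ < 0 ∨ t₁ < 0) :
    ∃ r s t : ℝ, 0 ≤ r ∧ r < 1 ∧ 0 ≤ s ∧ 0 ≤ t ∧ s + t < 1 ∧ (s = 0 ∨ t = 0) ∧
      s = s₀ + r * (s₁ - s₀) ∧ t = (1 - s₀) + r * (t₁ - (1 - s₀)) := by
  set f : ℝ → ℝ := fun r => min (s₀ + r * (s₁ - s₀)) ((1 - s₀) + r * (t₁ - (1 - s₀))) with hf
  have hcont : ContinuousOn f (Icc 0 1) := by
    apply Continuous.continuousOn
    fun_prop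
  have h0 : 0 < f 0 := by
    simp only [hf, lt_min_iff]
    constructor <;> linarith
  have h1 : f 1 < 0 := by
    simp only [hf, min_lt_iff]
    rcases hneg with h | h
    · left; linarith
    · right; linarith
  obtain ⟨r, ⟨hr0, hr1⟩, hr⟩ := intermediate_value_Icc' zero_le_one hcont ⟨h1.le, h0.le⟩
  have hr1' : r < 1 := lt_of_le_of_ne hr1 (by rintro rfl; linarith)
  -- The start is interior to the third side, so both coordinates are positive there; `0 < r` is
  -- what makes `s + t < 1` strict.
  have hr0' : 0 < r := lt_of_le_of_ne hr0 (by rintro rfl; linarith)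
  have hnn : 0 ≤ f r := hr.ge
  simp only [hf, le_min_iff] at hnn
  refine ⟨r, _, _, hr0, hr1', hnn.1, hnn.2, ?_, ?_, rfl, rfl⟩
  · nlinarith
  · rcases min_choice (s₀ + r * (s₁ - s₀)) ((1 - s₀) + r * (t₁ - (1 - s₀))) with h' | h'
    · left; rw [← h']; exact hr
    · right; rw [← h']; exact hr

/-! ### Visibility inside the triangle of two visibility edges, and gift wrapping -/

section Visibility

variable {n : ℕ} {P : Finset Plane} {S : SimpleGraph P}

/-- A constraint that does not end in `u` does not cross a visibility edge of `u`. -/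
theorem not_cross_of_vis (hS : PlanarConstraints S) {u v a b : P} (huv : (vis S).Adj u v)
    (hab : S.Adj a b) (ha : a ≠ u) (hb : b ≠ u) {y : Plane}
    (hy : y ∈ openSegment ℝ (a : Plane) (b : Plane))
    (hy' : y ∈ openSegment ℝ (u : Plane) (v : Plane)) : False := by
  rcases huv.2 with h | h
  · refine Set.disjoint_left.1 (hS a b u v hab h ?_) hy hy'
    intro he
    rcases Sym2.eq_iff.1 he with ⟨h1, -⟩ | ⟨-, h2⟩
    · exact ha h1
    · exact hb h2
  · exact Set.disjoint_left.1 (h a b hab) hy' hy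

/-- The vertices other than `u` in the triangle `u v w`. -/
def otherVertices (P : Finset Plane) (u v w : Plane) : Set Plane :=
  {z | z ∈ P ∧ z ≠ u ∧ z ∈ triangle u v w}

theorem left_mem_triangle (u v w : Plane) : v ∈ triangle u v w :=
  ⟨1, 0, by norm_num, le_rfl, by norm_num, by module⟩

theorem right_mem_triangle (u v w : Plane) : w ∈ triangle u v w :=
  ⟨0, 1, le_rfl, by norm_num, by norm_num, by module⟩

/-- Follow the constraint from `x` towards `a`. If `a` is in the triangle, it is itself one of the
other vertices. Otherwise the constraint leaves the triangle, but not through the interior of the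
visibility edges `uv` and `uw`, nor through `u` by general position. So it leaves on the segment
`vw`, which is in the hull. -/
theorem exists_mem_convexHull_towards (hP : GeneralPosition n P) (hS : PlanarConstraints S)
    {u v w a b : P} (huv : (vis S).Adj u v) (huw : (vis S).Adj u w) (hvw : v ≠ w)
    (hab : S.Adj a b) (ha : a ≠ u) (hb : b ≠ u) {x : Plane}
    (hx : x ∈ openSegment ℝ (a : Plane) (b : Plane)) (hxT : x ∈ triangle u v w) :
    ∃ r : ℝ, 0 ≤ r ∧ r ≤ 1 ∧
      x + r • ((a : Plane) - x) ∈ convexHull ℝ (otherVertices P u v w) := by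
  have hv : (v : Plane) ∈ convexHull ℝ (otherVertices P u v w) := subset_convexHull _ _
    ⟨v.2, Subtype.coe_injective.ne huv.1.symm, left_mem_triangle _ _ _⟩
  have hw : (w : Plane) ∈ convexHull ℝ (otherVertices P u v w) := subset_convexHull _ _
    ⟨w.2, Subtype.coe_injective.ne huw.1.symm, right_mem_triangle _ _ _⟩
  by_cases haT : (a : Plane) ∈ triangle u v w
  · refine ⟨1, zero_le_one, le_rfl, ?_⟩
    rw [one_smul, add_sub_cancel]
    exact subset_convexHull _ _ ⟨a.2, Subtype.coe_injective.ne ha, haT⟩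
  obtain ⟨r, s, t, hr0, hr1, hs, ht, hst, hor, hy⟩ :=
    exists_exit_of_notMem_triangle (hP.cross_ne_zero huv.1 hvw huw.1) hxT haT
  have hy' := mem_openSegment_of_partway hx hr0 hr1
  refine ⟨r, hr0, hr1.le, ?_⟩
  have hne : x + r • ((a : Plane) - x) ≠ u := fun h =>
    hP.notMem_openSegment hab.ne ha hb (h ▸ hy')
  have hnuv := not_cross_of_vis hS huv hab ha hb hy'
  have hnuw := not_cross_of_vis hS huw hab ha hb hy'
  rw [hy] at hne hnuv hnuw ⊢
  rcases hor with rfl | rfl | hst1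
  · rcases eq_or_lt_of_le ht with rfl | ht0
    · exact absurd (by module) hne
    rcases eq_or_lt_of_le hst with h1 | h1
    · have : t = 1 := by linarith
      subst this
      convert hw using 1
      module
    · exact (hnuw (mem_openSegment_iff.2 ⟨t, ht0, by linarith, by module⟩)).elim
  · rcases eq_or_lt_of_le hs with rfl | hs0
    · exact absurd (by module) hne
    rcases eq_or_lt_of_le hst with h1 | h1
    · have : s = 1 := by linarith
      subst this
      convert hv using 1
      module
    · exact (hnuv (mem_openSegment_iff.2 ⟨s, hs0, by linarith, by module⟩)).elim
  · convert (convex_convexHull ℝ (otherVertices P u v w)) hv hw hs ht hst1 using 1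
    have : s = 1 - t := by linarith
    subst this
    module

/-- A constraint that does not end in `u` meets the triangle of two visibility edges `u v` and `u w`
only in the convex hull of the other vertices in this triangle. -/
theorem mem_convexHull_of_constraint (hP : GeneralPosition n P) (hS : PlanarConstraints S)
    {u v w a b : P} (huv : (vis S).Adj u v) (huw : (vis S).Adj u w) (hvw : v ≠ w)
    (hab : S.Adj a b) (ha : a ≠ u) (hb : b ≠ u) {x : Plane}
    (hx : x ∈ openSegment ℝ (a : Plane) (b : Plane)) (hxT : x ∈ triangle u v w) :
    x ∈ convexHull ℝ (otherVertices P u v w) := by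
  obtain ⟨r, hr0, hr1, hr⟩ := exists_mem_convexHull_towards hP hS huv huw hvw hab ha hb hx hxT
  obtain ⟨q, hq0, hq1, hq⟩ := exists_mem_convexHull_towards hP hS huv huw hvw hab.symm hb ha
    (openSegment_symm ℝ (a : Plane) (b : Plane) ▸ hx) hxT
  obtain ⟨t, ht0, ht1, rfl⟩ := mem_openSegment_iff.1 hx
  -- the two points are at the parameters `t (1 - r) ≤ t` and `t + q (1 - t) ≥ t`
  set x : Plane := (a : Plane) + t • ((b : Plane) - a) with hxdef
  -- For `r = 0` the hull point is `x` itself; excluding this case keeps the denominator of the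
  -- convex weights positive.
  rcases eq_or_lt_of_le hr0 with rfl | hr0
  · simpa using hr
  have hpos : 0 < t * r + q * (1 - t) := by
    have := mul_pos ht0 hr0
    have := mul_nonneg hq0 (by linarith : (0 : ℝ) ≤ 1 - t)
    linarith
  have := (convex_convexHull ℝ (otherVertices P u v w)) hr hq
    (a := q * (1 - t) / (t * r + q * (1 - t))) (b := t * r / (t * r + q * (1 - t)))
    (div_nonneg (mul_nonneg hq0 (by linarith)) hpos.le)
    (div_nonneg (mul_nonneg ht0.le hr0.le) hpos.le) (by field_simp; ring)
  convert this using 1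
  rw [hxdef]
  apply plane_ext <;>
  · simp only [PiLp.add_apply, PiLp.smul_apply, PiLp.sub_apply, smul_eq_mul]
    field_simp
    ring

theorem cross_coords (u v w : Plane) (s t s' t' : ℝ) :
    cross (s • (v - u) + t • (w - u)) (s' • (v - u) + t' • (w - u)) =
      (s * t' - t * s') * cross (v - u) (w - u) := by
  simp only [cross, PiLp.add_apply, PiLp.smul_apply, PiLp.sub_apply, smul_eq_mul]
  ring

/-- A vertex of the triangle of two visibility edges of `u` that is extreme in a direction facing `u`
is visible from `u`. -/
theorem vis_of_forall_le (hP : GeneralPosition n P) (hS : PlanarConstraints S)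
    {u v w q : P} (huv : (vis S).Adj u v) (huw : (vis S).Adj u w) (hvw : v ≠ w)
    (hq : (q : Plane) ∈ otherVertices P u v w) (l : Plane →ₗ[ℝ] ℝ) (hlu : l u < l q)
    (hl : ∀ z ∈ otherVertices P u v w, l q ≤ l z) : (vis S).Adj u q := by
  have huq : u ≠ q := fun h => hq.2.1 (by rw [h])
  refine ⟨huq, ?_⟩
  by_contra! hcon
  obtain ⟨hnadj, a, b, hab, hnd⟩ := hcon
  obtain ⟨x, hxq, hxab⟩ := Set.not_disjoint_iff.1 hnd
  -- A constraint from `u` through a point of `uq` would make `u`, `b` and `q` collinear.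
  have main : ∀ b : P, S.Adj u b → x ∉ openSegment ℝ (u : Plane) (b : Plane) := by
    intro b hub hx
    have hbq : b ≠ q := by rintro rfl; exact hnadj hub
    apply hP.cross_ne_zero hub.ne hbq huq
    obtain ⟨r, hr0, -, hr⟩ := mem_openSegment_iff.1 hxq
    have h0 := cross_eq_zero_of_mem_openSegment hx
    rw [hr] at h0
    simp only [cross, PiLp.add_apply, PiLp.smul_apply, PiLp.sub_apply, smul_eq_mul] at h0 ⊢
    apply mul_left_cancel₀ hr0.ne'
    linear_combination h0
  have ha : a ≠ u := by rintro rfl; exact main b hab hxab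
  have hb : b ≠ u := by
    rintro rfl
    rw [openSegment_symm] at hxab
    exact main a hab.symm hxab
  obtain ⟨r, hr0, hr1, hr⟩ := mem_openSegment_iff.1 hxq
  have hxT : x ∈ triangle u v w := by
    obtain ⟨s, t, hs, ht, hst, hqc⟩ := hq.2.2
    refine ⟨r * s, r * t, by positivity, by positivity, by nlinarith, ?_⟩
    rw [hr, hqc]
    module
  -- A blocking point is in the hull, where `l` is at least `l q`; but it is strictly between `u`
  -- and `q`, where `l` is less.
  have hx := mem_convexHull_of_constraint hP hS huv huw hvw hab ha hb hxab hxT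
  have hge : l q ≤ l x :=
    convexHull_min (s := otherVertices P u v w) (t := {z | l q ≤ l z}) hl
      (convex_halfSpace_ge l.isLinear _) hx
  rw [hr, map_add, map_smul, map_sub, smul_eq_mul] at hge
  nlinarith

/-- In an empty triangle of two visibility edges of `u` that contains no constraint starting at `u`,
the third side is a visibility edge, too. -/
theorem vis_of_empty_triangle (hP : GeneralPosition n P) (hS : PlanarConstraints S)
    {u v p : P} (huv : (vis S).Adj u v) (hup : (vis S).Adj u p) (hvp : v ≠ p)
    (hno : ∀ b : P, S.Adj u b → ∀ s t : ℝ, 0 < s → 0 < t →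
      (b : Plane) ≠ u + s • ((v : Plane) - u) + t • ((p : Plane) - u))
    (hempty : ∀ z : P, z ≠ u → (z : Plane) ∈ triangle u v p → z = v ∨ z = p) :
    (vis S).Adj v p := by
  have hD := hP.cross_ne_zero huv.1 hvp hup.1
  refine ⟨hvp, ?_⟩
  by_contra! hcon
  obtain ⟨hnadj, a, b, hab, hnd⟩ := hcon
  obtain ⟨x, hxvp, hxab⟩ := Set.not_disjoint_iff.1 hnd
  obtain ⟨m, hm0, hm1, hxm⟩ := mem_openSegment_iff.1 hxvp
  -- A constraint from `u` through the interior of `vp` would run strictly between `uv` and `up`.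
  have start : ∀ b : P, S.Adj u b → x ∉ openSegment ℝ (u : Plane) (b : Plane) := by
    intro b hub hx
    obtain ⟨r, hr0, -, hr⟩ := mem_openSegment_iff.1 hx
    refine hno b hub ((1 - m) / r) (m / r) (div_pos (by linarith) hr0) (div_pos hm0 hr0) ?_
    rw [hxm] at hr
    have h0 := congrArg (fun p : Plane => p 0) hr
    have h1 := congrArg (fun p : Plane => p 1) hr
    simp only [PiLp.add_apply, PiLp.smul_apply, PiLp.sub_apply, smul_eq_mul] at h0 h1
    apply plane_ext <;>
    · simp only [PiLp.add_apply, PiLp.smul_apply, PiLp.sub_apply, smul_eq_mul]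
      field_simp
      linarith
  have ha : a ≠ u := by rintro rfl; exact start b hab hxab
  have hb : b ≠ u := by
    rintro rfl
    rw [openSegment_symm] at hxab
    exact start a hab.symm hxab
  -- An endpoint on the side of `u` of the line `vp` is outside the empty triangle, so the
  -- constraint would have to leave the triangle through `uv` or `up`.
  have below : ∀ a b : P, S.Adj a b → a ≠ u → b ≠ u →
      x ∈ openSegment ℝ (a : Plane) (b : Plane) → ∀ s t : ℝ,
      (a : Plane) = u + s • ((v : Plane) - u) + t • ((p : Plane) - u) → ¬ s + t < 1 := by
    intro a b hab ha hb hx s t hac hst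
    have hneg : s < 0 ∨ t < 0 := by
      by_contra! hnn
      have haT : (a : Plane) ∈ triangle u v p := ⟨s, t, hnn.1, hnn.2, hst.le, hac⟩
      rcases hempty a ha haT with rfl | rfl
      · have := coords_unique hD (s := 1) (t := 0) (s' := s) (t' := t) (by rw [← hac]; module)
        linarith
      · have := coords_unique hD (s := 0) (t := 1) (s' := s) (t' := t) (by rw [← hac]; module)
        linarith
    obtain ⟨r, s', t', hr0, hr1, hs', ht', hst', hor, hsr, htr⟩ :=
      exists_exit_of_start_mem_side (s₀ := 1 - m) (by linarith) (by linarith) hst hneg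
    have hy := mem_openSegment_of_partway hx hr0 hr1
    have hyc : x + r • ((a : Plane) - x) = u + s' • ((v : Plane) - u) + t' • ((p : Plane) - u) := by
      rw [hxm, hac, hsr, htr]
      module
    rw [hyc] at hy
    have hu := hP.notMem_openSegment hab.ne ha hb
    rcases hor with rfl | rfl
    · rcases eq_or_lt_of_le ht' with rfl | ht0
      · apply hu
        convert hy using 1
        module
      · exact not_cross_of_vis hS hup hab ha hb hy
          (mem_openSegment_iff.2 ⟨t', ht0, by linarith, by module⟩)
    · rcases eq_or_lt_of_le hs' with rfl | hs0
      · apply hu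
        convert hy using 1
        module
      · exact not_cross_of_vis hS huv hab ha hb hy
          (mem_openSegment_iff.2 ⟨s', hs0, by linarith, by module⟩)
  obtain ⟨s₁, t₁, h₁⟩ := exists_coords hD (a : Plane)
  obtain ⟨s₂, t₂, h₂⟩ := exists_coords hD (b : Plane)
  have g₁ := below a b hab ha hb hxab s₁ t₁ h₁
  have g₂ := below b a hab.symm hb ha (openSegment_symm ℝ (a : Plane) (b : Plane) ▸ hxab) s₂ t₂ h₂
  obtain ⟨r, hr0, hr1, hr⟩ := mem_openSegment_iff.1 hxab
  have hu := coords_unique hD (s := 1 - m) (t := m) (s' := s₁ + r * (s₂ - s₁))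
    (t' := t₁ + r * (t₂ - t₁)) (by
      trans x
      · rw [hxm]; module
      · rw [hr, h₁, h₂]; module)
  -- The crossing point has coordinate sum 1 and is strictly between endpoints with sums at least 1,
  -- so both endpoints are on the line `vp`.
  have e₁ : s₁ + t₁ = 1 := by nlinarith
  have e₂ : s₂ + t₂ = 1 := by nlinarith
  have online : ∀ a : P, ∀ s t : ℝ, s + t = 1 →
      (a : Plane) = u + s • ((v : Plane) - u) + t • ((p : Plane) - u) → a = v ∨ a = p := by
    intro a s t hst hac
    by_contra! hne
    apply hP.cross_ne_zero hvp hne.2.symm hne.1.symm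
    rw [hac]
    simp only [cross, PiLp.add_apply, PiLp.smul_apply, PiLp.sub_apply, smul_eq_mul]
    have : s = 1 - t := by linarith
    subst this
    ring
  rcases online a s₁ t₁ e₁ h₁ with rfl | rfl <;> rcases online b s₂ t₂ e₂ h₂ with rfl | rfl
  · exact hab.ne rfl
  · exact hnadj hab
  · exact hnadj hab.symm
  · exact hab.ne rfl

/-- The step of gift wrapping: the successor `p` of `v` on the convex chain from `v` to `w` in the
triangle of the visibility edges `u v` and `u w`. -/
theorem exists_chain_successor (hP : GeneralPosition n P) (hS : PlanarConstraints S)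
    {u v w : P} (huv : (vis S).Adj u v) (huw : (vis S).Adj u w) (hvw : v ≠ w)
    (hno : ∀ b : P, S.Adj u b → ∀ s t : ℝ, 0 < s → 0 < t →
      (b : Plane) ≠ u + s • ((v : Plane) - u) + t • ((w : Plane) - u)) :
    ∃ (p : P) (s₀ t₀ : ℝ), 0 ≤ s₀ ∧ 0 < t₀ ∧ s₀ + t₀ ≤ 1 ∧
      (p : Plane) = u + s₀ • ((v : Plane) - u) + t₀ • ((w : Plane) - u) ∧
      (vis S).Adj u p ∧ (vis S).Adj v p ∧
      ∀ z : P, z ≠ u → ∀ s t : ℝ, 0 ≤ s → 0 ≤ t → s + t ≤ 1 →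
        (z : Plane) = u + s • ((v : Plane) - u) + t • ((w : Plane) - u) →
        t₀ * (1 - s) ≤ (1 - s₀) * t := by
  classical
  have hD := hP.cross_ne_zero huv.1 hvw huw.1
  choose cs ct hc using exists_coords hD
  set Q : Finset P := Finset.univ.filter fun z => z ≠ u ∧ z ≠ v ∧ (z : Plane) ∈ triangle u v w
    with hQ
  have hcoords : ∀ z : P, ∀ s t : ℝ, (z : Plane) = u + s • ((v : Plane) - u) + t • ((w : Plane) - u) →
      cs z = s ∧ ct z = t := by
    intro z s t hz
    exact coords_unique hD (by rw [← hc, hz])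
  have hpos : ∀ z ∈ Q, 0 ≤ cs z ∧ 0 < ct z ∧ cs z + ct z ≤ 1 := by
    intro z hz
    obtain ⟨hzu, hzv, s, t, hs, ht, hst, hzc⟩ := (Finset.mem_filter.1 hz).2
    obtain ⟨rfl, rfl⟩ := hcoords z s t hzc
    refine ⟨hs, lt_of_le_of_ne ht ?_, hst⟩
    intro h0
    apply hP.cross_ne_zero huv.1 (Ne.symm hzv) (Ne.symm hzu)
    rw [hzc, ← h0]
    simp only [cross, PiLp.add_apply, PiLp.smul_apply, PiLp.sub_apply, smul_eq_mul]
    ring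
  have hwQ : w ∈ Q := Finset.mem_filter.2
    ⟨Finset.mem_univ _, huw.1.symm, hvw.symm, right_mem_triangle _ _ _⟩
  -- The ratio is `(1 - s) / t - 1`, where `z - v = -(1 - s) (v - u) + t (w - u)`. Maximizing it
  -- selects the first vertex met by a ray that turns about `v` away from `vu`.
  obtain ⟨p, hpQ, hmax⟩ := Q.exists_max_image (fun z => (1 - cs z - ct z) / ct z) ⟨w, hwQ⟩
  obtain ⟨hp0, hp1, hp2⟩ := hpos p hpQ
  obtain ⟨hpu, hpv, hpT⟩ := (Finset.mem_filter.1 hpQ).2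
  have hside : ∀ z : P, z ≠ u → ∀ s t : ℝ, 0 ≤ s → 0 ≤ t → s + t ≤ 1 →
      (z : Plane) = u + s • ((v : Plane) - u) + t • ((w : Plane) - u) →
      ct p * (1 - s) ≤ (1 - cs p) * t := by
    intro z hzu s t hs ht hst hzc
    by_cases hzv : z = v
    · subst hzv
      have := coords_unique hD (s := 1) (t := 0) (s' := s) (t' := t) (by rw [← hzc]; module)
      rw [← this.1, ← this.2]
      simp
    have hzQ : z ∈ Q := Finset.mem_filter.2
      ⟨Finset.mem_univ _, hzu, hzv, s, t, hs, ht, hst, hzc⟩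
    obtain ⟨rfl, rfl⟩ := hcoords z s t hzc
    have h1 := hmax z hzQ
    rw [div_le_div_iff₀ (hpos z hzQ).2.1 hp1] at h1
    linarith
  have hup : (vis S).Adj u p := by
    -- `d` is `p - v`, so the functional `l` below is constant on lines parallel to `vp`. The factor
    -- `D` orients it to grow away from `u`.
    set d : Plane := (cs p - 1) • ((v : Plane) - u) + ct p • ((w : Plane) - u) with hd
    set D := cross ((v : Plane) - u) ((w : Plane) - u) with hDdef
    let l : Plane →ₗ[ℝ] ℝ :=
      { toFun := fun z => -(D * cross d z)
        map_add' := fun x y => by simp only [cross, PiLp.add_apply]; ring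
        map_smul' := fun r x => by
          simp only [cross, PiLp.smul_apply, smul_eq_mul, RingHom.id_apply]; ring }
    have hl : ∀ s t : ℝ, l (u + s • ((v : Plane) - u) + t • ((w : Plane) - u)) =
        l u + D ^ 2 * ((1 - cs p) * t + ct p * s) := by
      intro s t
      have : u + s • ((v : Plane) - u) + t • ((w : Plane) - u) =
        u + (s • ((v : Plane) - u) + t • ((w : Plane) - u)) := by module
      rw [this, map_add]
      congr 1
      change -(D * cross d _) = _
      rw [hd, cross_coords]
      ring
    have hD2 : 0 < D ^ 2 := by positivity
    refine vis_of_forall_le hP hS huv huw hvw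
      ⟨p.2, Subtype.coe_injective.ne hpu, hpT⟩ l ?_ ?_
    · rw [hc p, hl]
      have : 0 < (1 - cs p) * ct p + ct p * cs p := by nlinarith
      have := mul_pos hD2 this
      linarith
    · rintro z ⟨hzP, hzu, s, t, hs, ht, hst, hzc⟩
      have h1 := hside ⟨z, hzP⟩ (fun h => hzu (congrArg Subtype.val h)) s t hs ht hst hzc
      rw [hzc, hc p, hl, hl]
      have : D ^ 2 * ((1 - cs p) * ct p + ct p * cs p) ≤ D ^ 2 * ((1 - cs p) * t + ct p * s) :=
        mul_le_mul_of_nonneg_left (by linarith) hD2.le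
      linarith
  refine ⟨p, cs p, ct p, hp0, hp1, hp2, hc p, hup, ?_, hside⟩
  refine vis_of_empty_triangle hP hS huv hup (Ne.symm hpv) ?_ ?_
  · intro b hub s t hs ht hb
    refine hno b hub (s + t * cs p) (t * ct p) (by positivity) (by positivity) ?_
    conv at hb => rhs; rw [hc p]
    rw [hb]
    module
  -- By `hside` no vertex of the triangle is strictly on the side of `u` of the line `vp`, so
  -- another vertex in the triangle `uvp` would be on that line.
  · rintro z hzu ⟨s, t, hs, ht, hst, hz⟩
    by_contra! hne
    apply hP.cross_ne_zero (Ne.symm hpv) hne.2.symm hne.1.symm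
    have h1 := hside z hzu (s + t * cs p) (t * ct p) (by positivity) (by positivity)
      (by nlinarith) (by
        conv_lhs => rw [hz]
        conv_lhs => rw [hc p]
        module)
    have h2 : 1 ≤ s + t := by
      have : ct p * (1 - (s + t)) ≤ 0 := by linarith
      by_contra! hlt
      have := mul_pos hp1 (by linarith : 0 < 1 - (s + t))
      linarith
    have h3 : s = 1 - t := by linarith
    rw [hz, h3]
    simp only [cross, PiLp.add_apply, PiLp.smul_apply, PiLp.sub_apply, smul_eq_mul]
    ring

end Visibility

/-! ### Lengths of walks -/

section Walks

variable {P : Finset Plane} {G : SimpleGraph P}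

theorem walkLength_cons {u v w : P} (h : G.Adj u v) (p : G.Walk v w) :
    walkLength (SimpleGraph.Walk.cons h p) = dist (u : Plane) (v : Plane) + walkLength p := by
  simp [walkLength]

theorem walkLength_append {u v w : P} (p : G.Walk u v) (q : G.Walk v w) :
    walkLength (p.append q) = walkLength p + walkLength q := by
  simp [walkLength]

theorem walkLength_toWalk {u v : P} (h : G.Adj u v) :
    walkLength h.toWalk = dist (u : Plane) (v : Plane) := by
  simp [walkLength]

theorem exists_isPath_walkLength_le {u v : P} (p : G.Walk u v) :
    ∃ q : G.Walk u v, q.IsPath ∧ walkLength q ≤ walkLength p := by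
  classical
  refine ⟨p.bypass, p.bypass_isPath, ?_⟩
  refine List.Sublist.sum_le_sum (p.darts_bypass_sublist_darts.map _) ?_
  intro x hx
  obtain ⟨e, -, rfl⟩ := List.mem_map.1 hx
  exact dist_nonneg

end Walks

/-! ### Walks along the convex chain -/

theorem otherVertices_finite (P : Finset Plane) (u v w : Plane) : (otherVertices P u v w).Finite :=
  P.finite_toSet.subset fun _ hz => hz.1

theorem triangle_subset_of_mem {u v w p : Plane} (hp : p ∈ triangle u v w) :
    triangle u p w ⊆ triangle u v w := by
  obtain ⟨s₀, t₀, hs₀, ht₀, hst₀, rfl⟩ := hp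
  rintro z ⟨s, t, hs, ht, hst, rfl⟩
  refine ⟨s * s₀, s * t₀ + t, by positivity, by positivity, by nlinarith, by module⟩

variable {n : ℕ} {P : Finset Plane} {S : SimpleGraph P}

/-- The chain from `v` to `w` in the triangle of the visibility edges `u v` and `u w`, in coordinates
`X` and `Y` in which `v` lies to the left of `u w` and the chain ascends: if every edge of the chain
can be replaced by a walk whose length is at most the weight `A * Y + c * |X|` of the edge, then the
total length is bounded by the weight of a curve that first goes right, as far as `M`, and then
left. -/
theorem exists_walk_along_chain (hP : GeneralPosition n P) (hS : PlanarConstraints S)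
    {G : SimpleGraph P} {u w : P} (huw : (vis S).Adj u w) (X Y : Plane →ₗ[ℝ] ℝ) {τ A c K : ℝ}
    (hA : 0 ≤ A) (hc : 0 ≤ c)
    (hedge : ∀ p q : P, (vis S).Adj p q → 0 ≤ Y ((q : Plane) - p) →
      (0 ≤ X ((q : Plane) - p) ∨ |X ((q : Plane) - p)| ≤ τ * Y ((q : Plane) - p)) →
      A * Y ((q : Plane) - p) + c * |X ((q : Plane) - p)| < K →
      ∃ W : G.Walk p q, walkLength W ≤ A * Y ((q : Plane) - p) + c * |X ((q : Plane) - p)|)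
    (hYw : 0 < Y ((w : Plane) - u)) (hXw : |X ((w : Plane) - u)| ≤ τ * Y ((w : Plane) - u))
    (N : ℕ) : ∀ (v : P) (M : ℝ), (otherVertices P u v w).ncard ≤ N → (vis S).Adj u v → v ≠ w →
      0 < Y ((v : Plane) - u) → |X ((v : Plane) - u)| ≤ τ * Y ((v : Plane) - u) →
      0 < X ((w : Plane) - u) * Y ((v : Plane) - u) - Y ((w : Plane) - u) * X ((v : Plane) - u) →
      (∀ b : P, S.Adj u b → ∀ s t : ℝ, 0 < s → 0 < t →
        (b : Plane) ≠ u + s • ((v : Plane) - u) + t • ((w : Plane) - u)) →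
      (∀ z ∈ otherVertices P u v w, Y ((v : Plane) - u) ≤ Y (z - u) ∧ X (z - u) ≤ M) →
      A * Y ((w : Plane) - v) + c * (2 * M - X ((v : Plane) - u) - X ((w : Plane) - u)) < K →
      ∃ W : G.Walk v w, walkLength W ≤
        A * Y ((w : Plane) - v) + c * (2 * M - X ((v : Plane) - u) - X ((w : Plane) - u)) := by
  induction N with
  | zero =>
    intro v M hcard huv
    have h0 := (Set.ncard_eq_zero (otherVertices_finite P u v w)).1 (Nat.le_zero.1 hcard)
    have hv : (v : Plane) ∈ otherVertices P u v w :=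
      ⟨v.2, Subtype.coe_injective.ne huv.1.symm, left_mem_triangle _ _ _⟩
    rw [h0] at hv
    exact hv.elim
  | succ N ih =>
    intro v M hcard huv hvw hYv hXv hD hno hQ hK
    obtain ⟨p, s₀, t₀, hs₀, ht₀, hst₀, hpc, hup, hvp, hside⟩ :=
      exists_chain_successor hP hS huv huw hvw hno
    have hpT : (p : Plane) ∈ triangle u v w := ⟨s₀, t₀, hs₀, ht₀.le, hst₀, hpc⟩
    have hvQ : (v : Plane) ∈ otherVertices P u v w :=
      ⟨v.2, Subtype.coe_injective.ne huv.1.symm, left_mem_triangle _ _ _⟩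
    have hwQ : (w : Plane) ∈ otherVertices P u v w :=
      ⟨w.2, Subtype.coe_injective.ne huw.1.symm, right_mem_triangle _ _ _⟩
    have hpQ : (p : Plane) ∈ otherVertices P u v w :=
      ⟨p.2, Subtype.coe_injective.ne hup.1.symm, hpT⟩
    have hvM := (hQ v hvQ).2
    have hwM := (hQ w hwQ).2
    have hpY := (hQ p hpQ).1
    have hpM := (hQ p hpQ).2
    have hsub : ∀ (l : Plane →ₗ[ℝ] ℝ) (a b : Plane), l (a - b) = l (a - u) - l (b - u) := by
      intro l a b
      rw [← map_sub]
      congr 1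
      module
    have hpl : ∀ l : Plane →ₗ[ℝ] ℝ, l ((p : Plane) - u) =
        s₀ * l ((v : Plane) - u) + t₀ * l ((w : Plane) - u) := by
      intro l
      rw [← smul_eq_mul, ← smul_eq_mul, ← map_smul, ← map_smul, ← map_add]
      congr 1
      rw [hpc]
      module
    by_cases hpw : p = w
    · subst hpw
      have hXe : |X ((p : Plane) - v)| ≤ 2 * M - X ((v : Plane) - u) - X ((p : Plane) - u) := by
        rw [hsub X]
        exact abs_le.2 ⟨by linarith, by linarith⟩
      have hc' := mul_le_mul_of_nonneg_left hXe hc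
      have hYe : 0 ≤ Y ((p : Plane) - v) := by rw [hsub Y]; linarith
      have hdir : 0 ≤ X ((p : Plane) - v) ∨ |X ((p : Plane) - v)| ≤ τ * Y ((p : Plane) - v) := by
        by_contra! hcon
        obtain ⟨h1, h2⟩ := hcon
        rw [abs_of_neg h1] at h2
        rw [hsub X, hsub Y] at h2
        rw [hsub X] at h1
        have h3 := (abs_le.1 hXw).1
        nlinarith
      obtain ⟨W, hW⟩ := hedge v p hvp hYe hdir (by linarith)
      exact ⟨W, by linarith⟩
    have hs₀' : 0 < s₀ := by
      refine lt_of_le_of_ne hs₀ ?_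
      rintro rfl
      apply hP.cross_ne_zero huw.1 (Ne.symm hpw) hup.1
      rw [hpc]
      simp only [cross, PiLp.add_apply, PiLp.smul_apply, PiLp.sub_apply, smul_eq_mul]
      ring
    have hs₀1 : s₀ < 1 := by linarith
    have hYp : 0 < Y ((p : Plane) - u) := lt_of_lt_of_le hYv hpY
    have hXp : |X ((p : Plane) - u)| ≤ τ * Y ((p : Plane) - u) := by
      rw [hpl X, hpl Y]
      have hv' := abs_le.1 hXv
      have hw' := abs_le.1 hXw
      exact abs_le.2 ⟨by nlinarith, by nlinarith⟩
    have hDp : 0 < X ((w : Plane) - u) * Y ((p : Plane) - u) -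
        Y ((w : Plane) - u) * X ((p : Plane) - u) := by
      rw [hpl X, hpl Y]
      have := mul_pos hs₀' hD
      linarith
    have hDv : 0 < X ((p : Plane) - u) * Y ((v : Plane) - u) -
        Y ((p : Plane) - u) * X ((v : Plane) - u) := by
      rw [hpl X, hpl Y]
      have := mul_pos ht₀ hD
      linarith
    have hnop : ∀ b : P, S.Adj u b → ∀ s t : ℝ, 0 < s → 0 < t →
        (b : Plane) ≠ u + s • ((p : Plane) - u) + t • ((w : Plane) - u) := by
      intro b hub s t hs ht hb
      refine hno b hub (s * s₀) (s * t₀ + t) (by positivity) (by positivity) ?_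
      rw [hb, hpc]
      module
    have hsubset : otherVertices P u p w ⊆ otherVertices P u v w := fun z hz =>
      ⟨hz.1, hz.2.1, triangle_subset_of_mem hpT hz.2.2⟩
    -- Advancing from `v` to `p` discards at least the vertex `v`.
    have hcardp : (otherVertices P u p w).ncard ≤ N := by
      have hlt : (otherVertices P u p w).ncard < (otherVertices P u v w).ncard := by
        refine Set.ncard_lt_ncard ⟨hsubset, fun hsup => ?_⟩ (otherVertices_finite P u v w)
        obtain ⟨s, t, hs, ht, hst, hz⟩ := (hsup hvQ).2.2
        have := coords_unique (hP.cross_ne_zero huv.1 hvw huw.1) (s := 1) (t := 0)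
          (s' := s * s₀) (t' := s * t₀ + t) (by
            trans (v : Plane)
            · module
            · conv_lhs => rw [hz]
              rw [hpc]
              module)
        nlinarith
      omega
    -- Convexity of the chain: what remains is in the wedge at `p` spanned by the extensions of `vp`
    -- and `up` beyond `p`.
    have hz : ∀ z ∈ otherVertices P u p w, ∃ a b : ℝ, 0 ≤ a ∧ 0 ≤ b ∧
        ∀ l : Plane →ₗ[ℝ] ℝ, l (z - u) = l ((p : Plane) - u) + a * l ((p : Plane) - v) +
          b * l ((p : Plane) - u) := by
      rintro z ⟨hzP, hzu, s, t, hs, ht, hst, hzc⟩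
      have h1 := hside ⟨z, hzP⟩ (fun h => hzu (congrArg Subtype.val h)) (s * s₀) (s * t₀ + t)
        (by positivity) (by positivity) (by nlinarith) (by
          change z = _
          rw [hzc, hpc]
          module)
      refine ⟨s₀ * t / t₀, (s * t₀ + t * (1 - s₀) - t₀) / t₀, by positivity,
        div_nonneg (by linarith) ht₀.le, ?_⟩
      intro l
      have hzl : l (z - u) = s * l ((p : Plane) - u) + t * l ((w : Plane) - u) := by
        rw [← smul_eq_mul, ← smul_eq_mul, ← map_smul, ← map_smul, ← map_add]
        congr 1
        rw [hzc]
        module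
      rw [hzl, hsub l p v, hpl l]
      field_simp
      ring
    have hwQp : (w : Plane) ∈ otherVertices P u p w :=
      ⟨w.2, Subtype.coe_injective.ne huw.1.symm, right_mem_triangle _ _ _⟩
    have hYe : 0 ≤ Y ((p : Plane) - v) := by rw [hsub Y]; linarith
    have hQY : ∀ z ∈ otherVertices P u p w, Y ((p : Plane) - u) ≤ Y (z - u) := by
      intro z hzm
      obtain ⟨a, b, ha, hb, hl⟩ := hz z hzm
      rw [hl Y]
      have := mul_nonneg ha hYe
      have := mul_nonneg hb hYp.le
      linarith
    have hwY := hQY w hwQp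
    have eYwv := hsub Y w v
    have eYwp := hsub Y w p
    have eYpv := hsub Y p v
    have eXpv := hsub X p v
    have hAw : 0 ≤ A * Y ((w : Plane) - p) := mul_nonneg hA (by linarith)
    have hAe : 0 ≤ A * Y ((p : Plane) - v) := mul_nonneg hA hYe
    have hAsum : A * Y ((w : Plane) - v) = A * Y ((p : Plane) - v) + A * Y ((w : Plane) - p) := by
      rw [← mul_add]
      congr 1
      linarith
    -- An edge to the right uses up part of the budget to `M`, which stays the bound.
    rcases le_or_gt 0 (X ((p : Plane) - v)) with hXe | hXe
    · have h1 : 0 ≤ c * (2 * M - X ((p : Plane) - u) - X ((w : Plane) - u)) :=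
        mul_nonneg hc (by linarith)
      have h2 : c * (2 * M - X ((v : Plane) - u) - X ((w : Plane) - u)) =
          c * X ((p : Plane) - v) + c * (2 * M - X ((p : Plane) - u) - X ((w : Plane) - u)) := by
        rw [eXpv]
        ring
      have h3 := mul_nonneg hc hXe
      obtain ⟨W₁, hW₁⟩ := hedge v p hvp hYe (Or.inl hXe) (by
        rw [abs_of_nonneg hXe]
        linarith)
      rw [abs_of_nonneg hXe] at hW₁
      obtain ⟨W₂, hW₂⟩ := ih p M hcardp hup hpw hYp hXp hDp hnop
        (fun z hzm => ⟨hQY z hzm, (hQ z (hsubset hzm)).2⟩) (by linarith)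
      exact ⟨W₁.append W₂, by rw [walkLength_append]; linarith⟩
    -- After an edge to the left both generators of the wedge point left, so everything that remains
    -- is to the left of `p`, and `X (p - u)` replaces `M`. The edge itself is less inclined than
    -- `up`, hence within the cone.
    · have hkey : X ((p : Plane) - u) * Y ((p : Plane) - v) <
          Y ((p : Plane) - u) * X ((p : Plane) - v) := by
        rw [eXpv, eYpv]
        linarith
      have hneg : Y ((p : Plane) - u) * X ((p : Plane) - v) < 0 := mul_neg_of_pos_of_neg hYp hXe
      have hXp0 : X ((p : Plane) - u) < 0 := by
        by_contra! h
        have := mul_nonneg h hYe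
        linarith
      have hdir : |X ((p : Plane) - v)| ≤ τ * Y ((p : Plane) - v) := by
        rw [abs_of_neg hXe]
        have h1 := mul_le_mul_of_nonneg_right (abs_le.1 hXp).1 hYe
        by_contra! hcon
        have h2 := mul_lt_mul_of_pos_left hcon hYp
        linarith
      have hQX : ∀ z ∈ otherVertices P u p w, X (z - u) ≤ X ((p : Plane) - u) := by
        intro z hzm
        obtain ⟨a, b, ha, hb, hl⟩ := hz z hzm
        rw [hl X]
        have := mul_nonpos_of_nonneg_of_nonpos ha hXe.le
        have := mul_nonpos_of_nonneg_of_nonpos hb hXp0.le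
        linarith
      have h1 : 0 ≤ c * (2 * X ((p : Plane) - u) - X ((p : Plane) - u) - X ((w : Plane) - u)) :=
        mul_nonneg hc (by linarith [hQX w hwQp])
      have h2 : c * -X ((p : Plane) - v) +
          c * (2 * X ((p : Plane) - u) - X ((p : Plane) - u) - X ((w : Plane) - u)) ≤
          c * (2 * M - X ((v : Plane) - u) - X ((w : Plane) - u)) := by
        rw [← mul_add]
        exact mul_le_mul_of_nonneg_left (by linarith) hc
      have h3 : 0 ≤ c * -X ((p : Plane) - v) := mul_nonneg hc (by linarith)
      obtain ⟨W₁, hW₁⟩ := hedge v p hvp hYe (Or.inr hdir) (by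
        rw [abs_of_neg hXe]
        linarith)
      rw [abs_of_neg hXe] at hW₁
      obtain ⟨W₂, hW₂⟩ := ih p (X ((p : Plane) - u)) hcardp hup hpw hYp hXp hDp hnop
        (fun z hzm => ⟨hQY z hzm, hQX z hzm⟩) (by linarith)
      exact ⟨W₁.append W₂, by rw [walkLength_append]; linarith⟩

/-! ### Rotated orthonormal frames -/

/-- The coordinate along the unit vector at clockwise angle `ψ` from the vertical. -/
noncomputable def vert (ψ : ℝ) : Plane →ₗ[ℝ] ℝ where
  toFun d := d 0 * Real.sin ψ + d 1 * Real.cos ψ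
  map_add' x y := by simp only [PiLp.add_apply]; ring
  map_smul' r x := by simp only [PiLp.smul_apply, smul_eq_mul, RingHom.id_apply]; ring

/-- The coordinate perpendicular to `vert ψ`, growing in the clockwise direction. -/
noncomputable def hor (ψ : ℝ) : Plane →ₗ[ℝ] ℝ where
  toFun d := d 0 * Real.cos ψ - d 1 * Real.sin ψ
  map_add' x y := by simp only [PiLp.add_apply]; ring
  map_smul' r x := by simp only [PiLp.smul_apply, smul_eq_mul, RingHom.id_apply]; ring

theorem vert_apply (ψ : ℝ) (d : Plane) : vert ψ d = d 0 * Real.sin ψ + d 1 * Real.cos ψ := rfl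

theorem hor_apply (ψ : ℝ) (d : Plane) : hor ψ d = d 0 * Real.cos ψ - d 1 * Real.sin ψ := rfl

theorem dir_apply_zero (φ : ℝ) : dir φ 0 = Real.sin φ := by simp [dir]

theorem dir_apply_one (φ : ℝ) : dir φ 1 = Real.cos φ := by simp [dir]

theorem vert_dir (ψ φ : ℝ) : vert ψ (dir φ) = Real.cos (φ - ψ) := by
  rw [vert_apply, dir_apply_zero, dir_apply_one, Real.cos_sub]
  ring

theorem hor_dir (ψ φ : ℝ) : hor ψ (dir φ) = Real.sin (φ - ψ) := by
  rw [hor_apply, dir_apply_zero, dir_apply_one, Real.sin_sub]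

theorem vert_add (ψ δ : ℝ) (d : Plane) :
    vert (ψ + δ) d = vert ψ d * Real.cos δ + hor ψ d * Real.sin δ := by
  simp only [vert_apply, hor_apply, Real.sin_add, Real.cos_add]
  ring

theorem hor_add (ψ δ : ℝ) (d : Plane) :
    hor (ψ + δ) d = hor ψ d * Real.cos δ - vert ψ d * Real.sin δ := by
  simp only [vert_apply, hor_apply, Real.sin_add, Real.cos_add]
  ring

theorem hor_mul_vert_sub (ψ : ℝ) (p q : Plane) :
    hor ψ p * vert ψ q - vert ψ p * hor ψ q = cross p q := by
  simp only [vert_apply, hor_apply, cross]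
  linear_combination (p 0 * q 1 - p 1 * q 0) * Real.sin_sq_add_cos_sq ψ

theorem ext_hor_vert (ψ : ℝ) {p q : Plane} (h : hor ψ p = hor ψ q) (v : vert ψ p = vert ψ q) :
    p = q := by
  simp only [vert_apply, hor_apply] at h v
  apply plane_ext
  · linear_combination Real.cos ψ * h + Real.sin ψ * v +
      (q 0 - p 0) * Real.sin_sq_add_cos_sq ψ
  · linear_combination -Real.sin ψ * h + Real.cos ψ * v +
      (q 1 - p 1) * Real.sin_sq_add_cos_sq ψ

theorem hor_sq_add_vert_sq (ψ : ℝ) (d : Plane) : hor ψ d ^ 2 + vert ψ d ^ 2 = ‖d‖ ^ 2 := by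
  rw [EuclideanSpace.real_norm_sq_eq, Fin.sum_univ_two]
  simp only [vert_apply, hor_apply]
  linear_combination (d 0 ^ 2 + d 1 ^ 2) * Real.sin_sq_add_cos_sq ψ

theorem inner_dir (ψ : ℝ) (d : Plane) : inner ℝ d (dir ψ) = vert ψ d := by
  rw [PiLp.inner_apply, Fin.sum_univ_two, dir_apply_zero, dir_apply_one, vert_apply]
  simp
  ring

theorem norm_dir (ψ : ℝ) : ‖dir ψ‖ = 1 := by
  have h := hor_sq_add_vert_sq ψ (dir ψ)
  rw [hor_dir, vert_dir] at h
  simp only [sub_self, Real.sin_zero, Real.cos_zero] at h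
  have : ‖dir ψ‖ ^ 2 = 1 ^ 2 := by linarith
  exact (sq_eq_sq₀ (norm_nonneg _) zero_le_one).1 this

theorem dist_bisectorProj (n : ℕ) (u v : Plane) (i : Fin n) :
    dist u (bisectorProj n u i v) = |vert (i * theta n) (v - u)| := by
  rw [bisectorProj, bisector, inner_dir, dist_self_add_right, norm_smul, norm_dir, mul_one,
    Real.norm_eq_abs]

/-! ### Cones -/

section Cones

theorem theta_pos (hn : 5 ≤ n) : 0 < theta n := by
  have : (0 : ℝ) < n := by exact_mod_cast (by omega : 0 < n)
  unfold theta
  positivity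

theorem mul_theta (hn : 5 ≤ n) : (n : ℝ) * theta n = 2 * Real.pi := by
  have : (n : ℝ) ≠ 0 := by exact_mod_cast (by omega : n ≠ 0)
  unfold theta
  field_simp

theorem theta_le (hn : 5 ≤ n) : 5 * theta n ≤ 2 * Real.pi := by
  rw [← mul_theta hn]
  have : (5 : ℝ) ≤ n := by exact_mod_cast hn
  exact mul_le_mul_of_nonneg_right this (theta_pos hn).le

theorem cos_half_theta_pos (hn : 5 ≤ n) : 0 < Real.cos (theta n / 2) :=
  Real.cos_pos_of_mem_Ioo ⟨by linarith [theta_pos hn, Real.pi_pos],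
    by linarith [theta_le hn, Real.pi_pos]⟩

theorem sin_half_theta_pos (hn : 5 ≤ n) : 0 < Real.sin (theta n / 2) :=
  Real.sin_pos_of_pos_of_lt_pi (by linarith [theta_pos hn])
    (by linarith [theta_le hn, Real.pi_pos])

theorem tan_half_theta_pos (hn : 5 ≤ n) : 0 < Real.tan (theta n / 2) := by
  rw [Real.tan_eq_sin_div_cos]
  exact div_pos (sin_half_theta_pos hn) (cos_half_theta_pos hn)

theorem hor_leftRay (i : Fin n) : hor (i * theta n) (leftRay n i) = -Real.sin (theta n / 2) := by
  rw [leftRay, hor_dir, ← Real.sin_neg]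
  congr 1
  ring

theorem vert_leftRay (i : Fin n) : vert (i * theta n) (leftRay n i) = Real.cos (theta n / 2) := by
  rw [leftRay, vert_dir, ← Real.cos_neg]
  congr 1
  ring

theorem hor_rightRay (i : Fin n) : hor (i * theta n) (rightRay n i) = Real.sin (theta n / 2) := by
  rw [rightRay, hor_dir]
  congr 1
  ring

theorem vert_rightRay (i : Fin n) :
    vert (i * theta n) (rightRay n i) = Real.cos (theta n / 2) := by
  rw [rightRay, vert_dir]
  congr 1
  ring

/-- Turns membership in a cone into a slope condition in the frame of its bisector, the form used in
all estimates. -/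
theorem mem_cone_iff (hn : 5 ≤ n) {u w : Plane} {i : Fin n} : w ∈ cone n u i ↔
    |hor (i * theta n) (w - u)| ≤ Real.tan (theta n / 2) * vert (i * theta n) (w - u) := by
  have hs := sin_half_theta_pos hn
  have hc := cos_half_theta_pos hn
  rw [Real.tan_eq_sin_div_cos]
  constructor
  · rintro ⟨s, t, h0, h1, rfl⟩
    have : u + s • leftRay n i + t • rightRay n i - u = s • leftRay n i + t • rightRay n i := by
      module
    rw [this, map_add, map_add, map_smul, map_smul, map_smul, map_smul, hor_leftRay, hor_rightRay,
      vert_leftRay, vert_rightRay]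
    simp only [smul_eq_mul]
    have : Real.sin (theta n / 2) / Real.cos (theta n / 2) *
        (s * Real.cos (theta n / 2) + t * Real.cos (theta n / 2)) =
        (s + t) * Real.sin (theta n / 2) := by
      field_simp
    rw [this, abs_le]
    have := mul_nonneg h0 hs.le
    have := mul_nonneg h1 hs.le
    constructor <;> linarith
  · intro h
    obtain ⟨h1, h2⟩ := abs_le.1 h
    set V := vert (i * theta n) (w - u) with hV
    set H := hor (i * theta n) (w - u) with hH
    have e : ∀ r : ℝ, (V / Real.cos (theta n / 2) + r / Real.sin (theta n / 2)) / 2 =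
        (Real.sin (theta n / 2) / Real.cos (theta n / 2) * V + r) /
          (2 * Real.sin (theta n / 2)) := by
      intro r
      field_simp
    refine ⟨(V / Real.cos (theta n / 2) + -H / Real.sin (theta n / 2)) / 2,
      (V / Real.cos (theta n / 2) + H / Real.sin (theta n / 2)) / 2, ?_, ?_, ?_⟩
    · rw [e]
      exact div_nonneg (by linarith) (by linarith)
    · rw [e]
      exact div_nonneg (by linarith) (by linarith)
    · rw [add_assoc, ← sub_eq_iff_eq_add']
      apply ext_hor_vert (i * theta n)
      · rw [← hH, map_add, map_smul, map_smul, hor_leftRay, hor_rightRay]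
        simp only [smul_eq_mul]
        field_simp
        ring
      · rw [← hV, map_add, map_smul, map_smul, vert_leftRay, vert_rightRay]
        simp only [smul_eq_mul]
        field_simp
        ring

theorem vert_pos_of_abs_hor_le {ψ τ : ℝ} (hτ : 0 < τ) {d : Plane} (hd : d ≠ 0)
    (h : |hor ψ d| ≤ τ * vert ψ d) : 0 < vert ψ d := by
  by_contra! hneg
  have h1 : τ * vert ψ d ≤ 0 := mul_nonpos_of_nonneg_of_nonpos hτ.le hneg
  have h2 : hor ψ d = 0 := abs_eq_zero.1 (le_antisymm (h.trans h1) (abs_nonneg _))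
  have h3 : vert ψ d = 0 := by
    rw [h2, abs_zero] at h
    rcases mul_eq_zero.1 (le_antisymm h1 h) with h' | h'
    · exact absurd h' hτ.ne'
    · exact h'
  exact hd (ext_hor_vert ψ (by rw [h2, map_zero]) (by rw [h3, map_zero]))

theorem norm_le_of_abs_hor_le {ψ β : ℝ} (hβ : 0 < Real.cos β) {d : Plane}
    (hv : 0 ≤ vert ψ d) (h : |hor ψ d| ≤ Real.tan β * vert ψ d) :
    ‖d‖ ≤ vert ψ d / Real.cos β := by
  refine le_of_sq_le_sq ?_ (div_nonneg hv hβ.le)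
  rw [← hor_sq_add_vert_sq ψ, ← sq_abs]
  have h1 := pow_le_pow_left₀ (abs_nonneg _) h 2
  have h2 : (vert ψ d / Real.cos β) ^ 2 = (Real.tan β * vert ψ d) ^ 2 + vert ψ d ^ 2 := by
    rw [Real.tan_eq_sin_div_cos]
    field_simp
    linear_combination -(vert ψ d) ^ 2 * Real.sin_sq_add_cos_sq β
  linarith

/-- Cones are numbered modulo `n`. -/
theorem exists_cone_index (hn : 5 ≤ n) (m : ℤ) :
    ∃ (j : Fin n) (q : ℤ), (j : ℝ) * theta n = m * theta n - q * (2 * Real.pi) := by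
  have hn0 : (0 : ℤ) < n := by omega
  refine ⟨⟨(m % n).toNat, ?_⟩, m / n, ?_⟩
  · have := Int.emod_lt_of_pos m hn0
    have := Int.emod_nonneg m hn0.ne'
    omega
  · have h1 : (((m % n).toNat : ℤ) : ℝ) = ((m - n * (m / n) : ℤ) : ℝ) := by
      rw [Int.toNat_of_nonneg (Int.emod_nonneg m hn0.ne'), Int.emod_def]
    push_cast at h1
    rw [h1, ← mul_theta hn]
    ring

theorem dir_sub_int_mul (x : ℝ) (q : ℤ) : dir (x - q * (2 * Real.pi)) = dir x := by
  simp [dir, Real.sin_sub_int_mul_two_pi, Real.cos_sub_int_mul_two_pi]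

/-- General position speaks of left rays only; this extends it to right rays. -/
theorem exists_leftRay_eq_rightRay (hn : 5 ≤ n) (i : Fin n) :
    ∃ j : Fin n, leftRay n j = rightRay n i := by
  obtain ⟨j, q, h⟩ := exists_cone_index hn ((i : ℤ) + 1)
  refine ⟨j, ?_⟩
  rw [leftRay, rightRay, sub_mul, h, sub_right_comm, dir_sub_int_mul]
  congr 1
  push_cast
  ring

end Cones

/-! ### Weights -/

/-- The weight of a unit of horizontal length in a bound on the length of walks. -/
noncomputable def horFactor (θ : ℝ) : ℝ := Real.cos (θ / 4) / (Real.cos (θ / 2) - Real.sin (3 * θ / 4))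

/-- The weight of a unit of vertical length in a bound on the length of walks. -/
noncomputable def vertFactor (θ : ℝ) : ℝ := 1 / Real.cos (θ / 2) + horFactor θ * Real.tan (θ / 2)

/-- The sine is the cosine of π/2 - 3θ/4, and this angle exceeds θ/2 exactly when 5θ < 2π. -/
theorem horFactor_denom_pos {θ : ℝ} (h0 : 0 < θ) (h1 : 5 * θ < 2 * Real.pi) :
    0 < Real.cos (θ / 2) - Real.sin (3 * θ / 4) := by
  rw [sub_pos, ← Real.cos_pi_div_two_sub]
  exact Real.cos_lt_cos_of_nonneg_of_le_pi_div_two (by linarith) (by linarith) (by linarith)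

theorem horFactor_pos {θ : ℝ} (h0 : 0 < θ) (h1 : 5 * θ < 2 * Real.pi) : 0 < horFactor θ :=
  div_pos (Real.cos_pos_of_mem_Ioo ⟨by linarith, by linarith⟩) (horFactor_denom_pos h0 h1)

theorem vertFactor_pos {θ : ℝ} (h0 : 0 < θ) (h1 : 5 * θ < 2 * Real.pi) : 0 < vertFactor θ := by
  have := horFactor_pos h0 h1
  have hc : 0 < Real.cos (θ / 2) := Real.cos_pos_of_mem_Ioo ⟨by linarith, by linarith⟩
  have ht : 0 < Real.tan (θ / 2) := Real.tan_pos_of_pos_of_lt_pi_div_two (by linarith) (by linarith)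
  unfold vertFactor
  positivity

/-- The derivative of `A cos φ + c sin φ` vanishes at π/4 + θ/8, the midpoint of θ/4 and π/2,
because the function agrees at these two angles. -/
theorem vertFactor_mul_sin_eq {θ : ℝ} (h0 : 0 < θ) (h1 : 5 * θ < 2 * Real.pi) :
    vertFactor θ * Real.sin (Real.pi / 4 + θ / 8) =
      horFactor θ * Real.cos (Real.pi / 4 + θ / 8) := by
  have hd := horFactor_denom_pos h0 h1
  have hc : 0 < Real.cos (θ / 2) := Real.cos_pos_of_mem_Ioo ⟨by linarith, by linarith⟩
  have hdef : horFactor θ * (Real.cos (θ / 2) - Real.sin (3 * θ / 4)) = Real.cos (θ / 4) :=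
    div_mul_cancel₀ _ hd.ne'
  -- the weights of the directions `θ / 4` and `π / 2` agree
  have key : vertFactor θ * Real.cos (θ / 4) + horFactor θ * Real.sin (θ / 4) = horFactor θ := by
    rw [vertFactor, Real.tan_eq_sin_div_cos]
    have : Real.sin (3 * θ / 4) = Real.sin (θ / 2) * Real.cos (θ / 4) +
        Real.cos (θ / 2) * Real.sin (θ / 4) := by
      rw [← Real.sin_add]
      congr 1
      ring
    rw [this] at hdef
    field_simp
    linarith
  set s := Real.pi / 4 + θ / 8 with hs
  -- Chosen so that `s - r` is θ/4 and `s + r` is π/2.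
  set r := Real.pi / 4 - θ / 8 with hr
  have e1 : Real.cos (θ / 4) = Real.cos s * Real.cos r + Real.sin s * Real.sin r := by
    rw [← Real.cos_sub]; congr 1; rw [hs, hr]; ring
  have e2 : Real.sin (θ / 4) = Real.sin s * Real.cos r - Real.cos s * Real.sin r := by
    rw [← Real.sin_sub]; congr 1; rw [hs, hr]; ring
  have e3 : (1 : ℝ) = Real.sin s * Real.cos r + Real.cos s * Real.sin r := by
    rw [← Real.sin_add, ← Real.sin_pi_div_two]; congr 1; rw [hs, hr]; ring
  have e4 : (0 : ℝ) = Real.cos s * Real.cos r - Real.sin s * Real.sin r := by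
    rw [← Real.cos_add, ← Real.cos_pi_div_two]; congr 1; rw [hs, hr]; ring
  have hsin : 0 < Real.sin r := Real.sin_pos_of_pos_of_lt_pi (by linarith) (by linarith)
  apply mul_right_cancel₀ (mul_pos two_pos hsin).ne'
  linear_combination key - vertFactor θ * e1 - horFactor θ * e2 + horFactor θ * e3 +
    vertFactor θ * e4

/-- The weight of a direction is at least that of a direction closer to the vertical, as long as the
two angles do not add up to too much. -/
theorem weight_le_weight {θ g φ : ℝ} (h0 : 0 < θ) (h1 : 5 * θ < 2 * Real.pi) (hg : |g| ≤ φ)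
    (h : φ + |g| ≤ Real.pi / 2 + θ / 4) :
    vertFactor θ * Real.cos g + horFactor θ * |Real.sin g| ≤
      vertFactor θ * Real.cos φ + horFactor θ * Real.sin φ := by
  have hg0 := abs_nonneg g
  have hsg : |Real.sin g| = Real.sin |g| := by
    rcases le_total 0 g with h' | h'
    · rw [abs_of_nonneg h', abs_of_nonneg]
      rw [abs_of_nonneg h'] at hg h
      exact Real.sin_nonneg_of_nonneg_of_le_pi h' (by linarith)
    · rw [abs_of_nonpos h', Real.sin_neg, abs_of_nonpos]
      rw [abs_of_nonpos h'] at hg h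
      exact Real.sin_nonpos_of_nonpos_of_neg_pi_le h' (by linarith)
  rw [hsg, ← Real.cos_abs g]
  -- Sum to product: the two weights differ by `2 sin r (c cos s - A sin s)`, and the bracket is
  -- nonnegative as long as `s` does not pass the peak π/4 + θ/8.
  set s := (φ + |g|) / 2 with hs
  set r := (φ - |g|) / 2 with hr
  have eφ : φ = s + r := by rw [hs, hr]; ring
  have eg : |g| = s - r := by rw [hs, hr]; ring
  have hsin : 0 ≤ Real.sin r := Real.sin_nonneg_of_nonneg_of_le_pi (by linarith) (by linarith)
  have hA := vertFactor_pos h0 h1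
  have hc := horFactor_pos h0 h1
  have key : vertFactor θ * Real.sin s ≤ horFactor θ * Real.cos s := calc
    _ ≤ vertFactor θ * Real.sin (Real.pi / 4 + θ / 8) :=
      mul_le_mul_of_nonneg_left (Real.sin_le_sin_of_le_of_le_pi_div_two (by linarith)
        (by linarith) (by linarith)) hA.le
    _ = _ := vertFactor_mul_sin_eq h0 h1
    _ ≤ _ := mul_le_mul_of_nonneg_left (Real.cos_le_cos_of_nonneg_of_le_pi (by linarith)
        (by linarith) (by linarith)) hc.le
  rw [eg, eφ, Real.cos_add, Real.cos_sub, Real.sin_add, Real.sin_sub]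
  have := mul_le_mul_of_nonneg_right key hsin
  linarith

theorem exists_polar {x y : ℝ} (hx : 0 ≤ x) (hy : 0 ≤ y) : ∃ L φ : ℝ, 0 ≤ L ∧ 0 ≤ φ ∧
    φ ≤ Real.pi / 2 ∧ y = L * Real.cos φ ∧ x = L * Real.sin φ := by
  refine ⟨‖(⟨y, x⟩ : ℂ)‖, Complex.arg ⟨y, x⟩, norm_nonneg _, Complex.arg_nonneg_iff.2 hx,
    Complex.arg_le_pi_div_two_iff.2 (Or.inl hy), ?_, ?_⟩
  · rw [Complex.norm_mul_cos_arg]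
  · rw [Complex.norm_mul_sin_arg]

theorem abs_sin_le_tan_mul_cos {g β : ℝ} (hβ : β < Real.pi / 2) (hg : |g| ≤ β) :
    |Real.sin g| ≤ Real.tan β * Real.cos g := by
  have hg' := abs_le.1 hg
  have hc : 0 < Real.cos β := Real.cos_pos_of_mem_Ioo ⟨by linarith, hβ⟩
  have habs : |Real.sin g| * Real.cos β = |Real.sin g * Real.cos β| := by
    rw [abs_mul, abs_of_pos hc]
  rw [Real.tan_eq_sin_div_cos, div_mul_eq_mul_div, le_div_iff₀ hc, habs]
  have h1 : 0 ≤ Real.sin (β - g) :=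
    Real.sin_nonneg_of_nonneg_of_le_pi (by linarith) (by linarith)
  have h2 : 0 ≤ Real.sin (β + g) :=
    Real.sin_nonneg_of_nonneg_of_le_pi (by linarith) (by linarith)
  rw [Real.sin_sub] at h1
  rw [Real.sin_add] at h2
  exact abs_le.2 ⟨by linarith, by linarith⟩

theorem weight_round_le {k : ℕ} {θ φ : ℝ} (hθ : (4 * k + 5) * θ = 2 * Real.pi) (h0 : 0 < θ)
    (h1 : 5 * θ < 2 * Real.pi) (hφ0 : 0 ≤ φ) (hφ1 : φ ≤ Real.pi / 2) {m : ℤ}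
    (hm : |φ - m * θ| ≤ θ / 2) :
    vertFactor θ * Real.cos (φ - m * θ) + horFactor θ * |Real.sin (φ - m * θ)| ≤
      vertFactor θ * Real.cos φ + horFactor θ * Real.sin φ := by
  obtain ⟨hm1, hm2⟩ := abs_le.1 hm
  have hm0 : 0 ≤ m := by
    by_contra! hneg
    have : (m : ℝ) ≤ -1 := by exact_mod_cast (by omega : m ≤ -1)
    nlinarith
  rcases hm0.eq_or_lt with rfl | hmpos
  · rw [Int.cast_zero, zero_mul, sub_zero,
      abs_of_nonneg (Real.sin_nonneg_of_nonneg_of_le_pi hφ0 (by linarith))]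
  have hm1' : (1 : ℝ) ≤ m := by exact_mod_cast hmpos
  -- Since π/2 = (k+1)θ + θ/4, an angle up to π/2 is rounded to at most (k+1)θ.
  have hmk : m ≤ k + 1 := by
    by_contra! hgt
    have : (k : ℝ) + 2 ≤ m := by exact_mod_cast (by omega : (k : ℤ) + 2 ≤ m)
    nlinarith
  have hmk' : (m : ℝ) ≤ k + 1 := by exact_mod_cast hmk
  have hmθ : (m : ℝ) * θ ≤ (k + 1) * θ := mul_le_mul_of_nonneg_right hmk' h0.le
  apply weight_le_weight h0 h1
  · have : θ ≤ m * θ := by nlinarith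
    linarith
  · rcases le_total 0 (φ - m * θ) with h | h
    · rw [abs_of_nonneg h]
      -- For `m = k + 1` the bound is attained at `φ = π/2`; for smaller `m` the sum of the angles
      -- is at most (k+1)θ, which is below π/2.
      rcases hmk.eq_or_lt with h' | h'
      · have : (m : ℝ) = k + 1 := by exact_mod_cast h'
        rw [this]
        linarith
      · have : (m : ℝ) ≤ k := by exact_mod_cast (by omega : m ≤ k)
        have := mul_le_mul_of_nonneg_right this h0.le
        linarith
    · rw [abs_of_nonpos h]
      linarith

/-- A vector that points upwards and to one side with respect to cone `i`, or lies in cone `i`, lies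
in some cone in which its weight is not larger than in cone `i`. -/
theorem exists_cone_weight_le {k : ℕ} (hk : 1 ≤ k) (i : Fin (4 * k + 5)) {σ : ℝ}
    (hσ : σ = 1 ∨ σ = -1) {d : Plane}
    (hv : 0 ≤ vert (i * theta (4 * k + 5)) d)
    (hd : 0 ≤ σ * hor (i * theta (4 * k + 5)) d ∨ |hor (i * theta (4 * k + 5)) d| ≤
      Real.tan (theta (4 * k + 5) / 2) * vert (i * theta (4 * k + 5)) d) :
    ∃ j : Fin (4 * k + 5), |hor (j * theta (4 * k + 5)) d| ≤
        Real.tan (theta (4 * k + 5) / 2) * vert (j * theta (4 * k + 5)) d ∧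
      vertFactor (theta (4 * k + 5)) * vert (j * theta (4 * k + 5)) d +
          horFactor (theta (4 * k + 5)) * |hor (j * theta (4 * k + 5)) d| ≤
        vertFactor (theta (4 * k + 5)) * vert (i * theta (4 * k + 5)) d +
          horFactor (theta (4 * k + 5)) * |hor (i * theta (4 * k + 5)) d| := by
  rcases hd with hd | hd
  swap
  · exact ⟨i, hd, le_rfl⟩
  have hn : 5 ≤ 4 * k + 5 := by omega
  have h0 := theta_pos hn
  have hnθ := mul_theta hn
  push_cast at hnθ
  have hk' : (1 : ℝ) ≤ k := by exact_mod_cast hk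
  have h1 : 5 * theta (4 * k + 5) < 2 * Real.pi := by nlinarith
  set θ := theta (4 * k + 5) with hθ
  obtain ⟨L, φ, hL, hφ0, hφ1, hV, hH⟩ := exists_polar hd hv
  -- The number of cones by which to turn, towards the side given by `σ`, to reach the bisector
  -- nearest to `d`.
  set m : ℤ := round (φ / θ) with hmdef
  have hm : |φ - m * θ| ≤ θ / 2 := by
    have h := abs_sub_round (φ / θ)
    rw [← hmdef] at h
    have e : φ - m * θ = (φ / θ - m) * θ := by field_simp
    rw [e, abs_mul, abs_of_pos h0]
    nlinarith
  have hH' : hor (i * θ) d = σ * (L * Real.sin φ) := by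
    rw [← hH]
    rcases hσ with rfl | rfl <;> ring
  have hrot : ∃ j : Fin (4 * k + 5), vert (j * θ) d = L * Real.cos (φ - m * θ) ∧
      hor (j * θ) d = σ * (L * Real.sin (φ - m * θ)) := by
    rcases hσ with rfl | rfl
    · obtain ⟨j, q, hj⟩ := exists_cone_index hn ((i : ℤ) + m)
      refine ⟨j, ?_⟩
      have e : (j : ℝ) * θ = i * θ + (m * θ - q * (2 * Real.pi)) := by
        rw [hj]; push_cast; ring
      rw [e, vert_add, hor_add, hV, hH', Real.cos_sub_int_mul_two_pi, Real.sin_sub_int_mul_two_pi,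
        Real.cos_sub, Real.sin_sub]
      constructor <;> ring
    · obtain ⟨j, q, hj⟩ := exists_cone_index hn ((i : ℤ) - m)
      refine ⟨j, ?_⟩
      have e : (j : ℝ) * θ = i * θ + (-(m * θ) - q * (2 * Real.pi)) := by
        rw [hj]; push_cast; ring
      rw [e, vert_add, hor_add, hV, hH', Real.cos_sub_int_mul_two_pi, Real.sin_sub_int_mul_two_pi,
        Real.cos_sub, Real.sin_sub, Real.cos_neg, Real.sin_neg]
      constructor <;> ring
  obtain ⟨j, hjv, hjh⟩ := hrot
  have habs : ∀ x : ℝ, |σ * (L * x)| = L * |x| := by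
    intro x
    rw [abs_mul, abs_mul, abs_of_nonneg hL]
    rcases hσ with rfl | rfl <;> simp
  refine ⟨j, ?_, ?_⟩
  · rw [hjv, hjh, habs]
    have := mul_le_mul_of_nonneg_left
      (abs_sin_le_tan_mul_cos (β := θ / 2) (by linarith) hm) hL
    linarith
  · rw [hjv, hjh, habs, hV, hH', habs,
      abs_of_nonneg (Real.sin_nonneg_of_nonneg_of_le_pi hφ0 (by linarith))]
    have := mul_le_mul_of_nonneg_left (weight_round_le hnθ h0 h1 hφ0 hφ1 hm) hL
    linarith

/-! ### Subcones -/

theorem sector_combo {u d e v w : Plane} (hv : v ∈ sector u d e) (hw : w ∈ sector u d e) {s t : ℝ}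
    (hs : 0 ≤ s) (ht : 0 ≤ t) : u + s • (v - u) + t • (w - u) ∈ sector u d e := by
  obtain ⟨s₁, t₁, hs₁, ht₁, rfl⟩ := hv
  obtain ⟨s₂, t₂, hs₂, ht₂, rfl⟩ := hw
  exact ⟨s * s₁ + t * s₂, s * t₁ + t * t₂, by positivity, by positivity, by module⟩

/-- A coefficient can vanish only if both vectors are on the same bounding ray, which the
determinant excludes. -/
theorem openSector_combo {u d e v w : Plane} (hv : v ∈ sector u d e) (hw : w ∈ sector u d e)
    (h : cross (v - u) (w - u) ≠ 0) {s t : ℝ} (hs : 0 < s) (ht : 0 < t) :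
    u + s • (v - u) + t • (w - u) ∈ openSector u d e := by
  obtain ⟨s₁, t₁, hs₁, ht₁, rfl⟩ := hv
  obtain ⟨s₂, t₂, hs₂, ht₂, rfl⟩ := hw
  have hcross : s₁ * t₂ - t₁ * s₂ ≠ 0 := by
    intro h0
    apply h
    simp only [cross, PiLp.add_apply, PiLp.smul_apply, PiLp.sub_apply, smul_eq_mul]
    linear_combination (d 0 * e 1 - d 1 * e 0) * h0
  refine ⟨s * s₁ + t * s₂, s * t₁ + t * t₂, ?_, ?_, by module⟩
  · refine lt_of_le_of_ne (by positivity) fun h0 => hcross ?_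
    have h1 : s * s₁ = 0 := by linarith [mul_nonneg hs.le hs₁, mul_nonneg ht.le hs₂]
    have h2 : t * s₂ = 0 := by linarith [mul_nonneg hs.le hs₁, mul_nonneg ht.le hs₂]
    rw [(mul_eq_zero.1 h1).resolve_left hs.ne', (mul_eq_zero.1 h2).resolve_left ht.ne']
    ring
  · refine lt_of_le_of_ne (by positivity) fun h0 => hcross ?_
    have h1 : s * t₁ = 0 := by linarith [mul_nonneg hs.le ht₁, mul_nonneg ht.le ht₂]
    have h2 : t * t₂ = 0 := by linarith [mul_nonneg hs.le ht₁, mul_nonneg ht.le ht₂]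
    rw [(mul_eq_zero.1 h1).resolve_left hs.ne', (mul_eq_zero.1 h2).resolve_left ht.ne']
    ring

theorem triangle_subset_sector {u d e v w : Plane} (hv : v ∈ sector u d e)
    (hw : w ∈ sector u d e) : triangle u v w ⊆ sector u d e := by
  rintro z ⟨s, t, hs, ht, -, rfl⟩
  exact sector_combo hv hw hs ht

theorem splitDirs_finite (S : SimpleGraph P) (u : P) (i : Fin n) : (splitDirs n S u i).Finite := by
  refine Set.Finite.union (by simp) ?_
  refine (Set.finite_range fun v : P => (v : Plane) - u).subset ?_
  rintro d ⟨v, -, -, rfl⟩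
  exact ⟨v, rfl⟩

theorem add_splitDirs_mem_cone {u : P} {i : Fin n} {d : Plane} (hd : d ∈ splitDirs n S u i) :
    (u : Plane) + d ∈ cone n u i := by
  rcases hd with (rfl | rfl) | ⟨v, -, hv, rfl⟩
  · exact ⟨1, 0, zero_le_one, le_rfl, by module⟩
  · exact ⟨0, 1, le_rfl, zero_le_one, by module⟩
  · rwa [add_sub_cancel]

theorem IsSubcone.subset_cone {u : P} {i : Fin n} {C : Set Plane} (hC : IsSubcone n S u i C) :
    C ⊆ cone n u i := by
  obtain ⟨d, hd, e, he, -, -, rfl⟩ := hC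
  rintro z ⟨s, t, hs, ht, rfl⟩
  have := sector_combo (add_splitDirs_mem_cone hd) (add_splitDirs_mem_cone he) hs ht
  rwa [add_sub_cancel_left, add_sub_cancel_left] at this

/-- No constraint of `u` runs between two points of the same subcone. -/
theorem IsSubcone.not_adj {u : P} {i : Fin n} {C : Set Plane} (hC : IsSubcone n S u i C)
    {v w : Plane} (hv : v ∈ C) (hw : w ∈ C) (h : cross (v - u) (w - u) ≠ 0) {b : P}
    (hub : S.Adj u b) {s t : ℝ} (hs : 0 < s) (ht : 0 < t) :
    (b : Plane) ≠ u + s • (v - u) + t • (w - u) := by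
  intro hb
  have hbcone : (b : Plane) ∈ cone n u i := by
    rw [hb]
    exact sector_combo (hC.subset_cone hv) (hC.subset_cone hw) hs.le ht.le
  obtain ⟨d, -, e, -, -, hopen, rfl⟩ := hC
  apply hopen (b - u) (Or.inr ⟨b, hub, hbcone, rfl⟩)
  rw [add_sub_cancel, hb]
  exact openSector_combo hv hw h hs ht

theorem splitDirs_ne_zero {u : P} {i : Fin n} {d : Plane}
    (hd : d ∈ splitDirs n S u i) : d ≠ 0 := by
  have hray : ∀ φ, dir φ ≠ 0 := fun φ h => by
    have := norm_dir φ
    rw [h, norm_zero] at this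
    exact zero_ne_one this
  rcases hd with (rfl | rfl) | ⟨v, huv, -, rfl⟩
  · exact hray _
  · exact hray _
  · exact sub_ne_zero.2 (Subtype.coe_injective.ne huv.ne.symm)

/-- Every vertex in a cone of `u` lies in one of the subcones. -/
theorem exists_isSubcone (hn : 5 ≤ n) (hP : GeneralPosition n P) (S : SimpleGraph P) {u w : P}
    (huw : u ≠ w) {i : Fin n} (hw : (w : Plane) ∈ cone n u i) :
    ∃ C, IsSubcone n S u i C ∧ (w : Plane) ∈ C := by
  have hτ := tan_half_theta_pos hn
  have hcos := cos_half_theta_pos hn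
  set V := vert (i * theta n) with hV
  set H := hor (i * theta n) with hH
  have hVpos : ∀ d ∈ splitDirs n S u i, 0 < V d := by
    intro d hd
    have h := (mem_cone_iff hn).1 (add_splitDirs_mem_cone hd)
    rw [add_sub_cancel_left] at h
    exact vert_pos_of_abs_hor_le hτ (splitDirs_ne_zero hd) h
  have hwc := (mem_cone_iff hn).1 hw
  have hVw : 0 < V ((w : Plane) - u) :=
    vert_pos_of_abs_hor_le hτ (sub_ne_zero.2 (Subtype.coe_injective.ne huw.symm)) hwc
  have hwc' := abs_le.1 hwc
  have hleft : leftRay n i ∈ splitDirs n S u i := Or.inl (Or.inl rfl)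
  have hright : rightRay n i ∈ splitDirs n S u i := Or.inl (Or.inr rfl)
  have hsl : H (leftRay n i) / V (leftRay n i) = -Real.tan (theta n / 2) := by
    rw [hH, hV, hor_leftRay, vert_leftRay, Real.tan_eq_sin_div_cos, neg_div]
  have hsr : H (rightRay n i) / V (rightRay n i) = Real.tan (theta n / 2) := by
    rw [hH, hV, hor_rightRay, vert_rightRay, Real.tan_eq_sin_div_cos]
  set m := H ((w : Plane) - u) / V ((w : Plane) - u) with hm
  have hml : -Real.tan (theta n / 2) ≤ m := by
    rw [hm, le_div_iff₀ hVw]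
    linarith
  -- Strict by general position, so that the right ray is a candidate for the bounding ray `e` of
  -- slope greater than `m`.
  have hmr : m < Real.tan (theta n / 2) := by
    refine lt_of_le_of_ne (by rw [hm, div_le_iff₀ hVw]; exact hwc'.2) fun h => ?_
    obtain ⟨j, hj⟩ := exists_leftRay_eq_rightRay hn i
    refine hP.not_parallel_ray u u.2 w w.2 (Subtype.coe_injective.ne huw) j
      (V ((w : Plane) - u) / Real.cos (theta n / 2)) ?_
    rw [hm, div_eq_iff hVw.ne', Real.tan_eq_sin_div_cos] at h
    rw [hj]
    apply ext_hor_vert (i * theta n)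
    · rw [map_smul, hor_rightRay, ← hH, h, smul_eq_mul]
      ring
    · rw [map_smul, vert_rightRay, ← hV, smul_eq_mul]
      field_simp
  have hfin := splitDirs_finite S u i
  -- The bounding rays of the subcone are the split directions whose slopes are next to that of `w`,
  -- from below and from above.
  obtain ⟨d, ⟨hd, hdm⟩, hdmax⟩ := (hfin.inter_of_left {f | H f / V f ≤ m}).exists_maximalFor
    (fun f => H f / V f) _ ⟨leftRay n i, hleft, by rw [mem_ofPred_eq, hsl]; exact hml⟩
  obtain ⟨e, ⟨he, hem⟩, hemin⟩ := (hfin.inter_of_left {f | m < H f / V f}).exists_minimalFor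
    (fun f => H f / V f) _ ⟨rightRay n i, hright, by rw [mem_ofPred_eq, hsr]; exact hmr⟩
  rw [mem_ofPred_eq] at hdm hem
  have hVd := hVpos d hd
  have hVe := hVpos e he
  have hde : H d / V d < H e / V e := hdm.trans_lt hem
  refine ⟨sector u d e, ⟨d, hd, e, he, by rintro rfl; exact lt_irrefl _ hde, ?_, rfl⟩, ?_⟩
  · rintro f hf ⟨s, t, hs, ht, hfe⟩
    rw [add_assoc, add_right_inj] at hfe
    have hVf := hVpos f hf
    have h1 : H d / V d < H f / V f := by
      rw [div_lt_div_iff₀ hVd hVe] at hde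
      rw [div_lt_div_iff₀ hVd hVf, hfe]
      simp only [map_add, map_smul, smul_eq_mul]
      have := mul_lt_mul_of_pos_left hde ht
      linarith
    have h2 : H f / V f < H e / V e := by
      rw [div_lt_div_iff₀ hVd hVe] at hde
      rw [div_lt_div_iff₀ hVf hVe, hfe]
      simp only [map_add, map_smul, smul_eq_mul]
      have := mul_lt_mul_of_pos_left hde hs
      linarith
    rcases le_or_gt (H f / V f) m with hfm | hfm
    · exact absurd (hdmax ⟨hf, hfm⟩ h1.le) (not_le.2 h1)
    · exact absurd (hemin ⟨hf, hfm⟩ h2.le) (not_le.2 h2)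
  · rw [hm, div_le_div_iff₀ hVd hVw] at hdm
    rw [hm, div_lt_div_iff₀ hVw hVe] at hem
    rw [div_lt_div_iff₀ hVd hVe] at hde
    have hD : 0 < H e * V d - H d * V e := by linarith
    refine ⟨(H e * V ((w : Plane) - u) - H ((w : Plane) - u) * V e) / (H e * V d - H d * V e),
      (H ((w : Plane) - u) * V d - H d * V ((w : Plane) - u)) / (H e * V d - H d * V e),
      div_nonneg (by linarith) hD.le, div_nonneg (by linarith) hD.le, ?_⟩
    rw [add_assoc, ← sub_eq_iff_eq_add']
    apply ext_hor_vert (i * theta n)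
    · rw [← hH, map_add, map_smul, map_smul, smul_eq_mul, smul_eq_mul, div_mul_eq_mul_div,
        div_mul_eq_mul_div, ← add_div, eq_div_iff hD.ne']
      ring
    · rw [← hV, map_add, map_smul, map_smul, smul_eq_mul, smul_eq_mul, div_mul_eq_mul_div,
        div_mul_eq_mul_div, ← add_div, eq_div_iff hD.ne']
      ring

/-! ### The induction on the weight -/

/-- The bound on the length of a walk that starts with a vector `d` into cone `i`. -/
noncomputable def weight (n : ℕ) (i : Fin n) (d : Plane) : ℝ :=
  vertFactor (theta n) * vert (i * theta n) d + horFactor (theta n) * |hor (i * theta n) d|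

theorem exists_closest {n : ℕ} {P : Finset Plane} (S : SimpleGraph P) {u w : P}
    (huw : (vis S).Adj u w) (i : Fin n) {C : Set Plane} (hC : IsSubcone n S u i C)
    (hw : (w : Plane) ∈ C) : ∃ v : P, (vis S).Adj u v ∧ (v : Plane) ∈ C ∧
      (thetaGraph n S).Adj u v ∧ ∀ z : P, (vis S).Adj u z → (z : Plane) ∈ C →
        |vert (i * theta n) ((v : Plane) - u)| ≤ |vert (i * theta n) ((z : Plane) - u)| := by
  obtain ⟨v, ⟨hv, hvC⟩, hmin⟩ := (Set.toFinite {v : P | (vis S).Adj u v ∧ (v : Plane) ∈ C}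
    ).exists_minimalFor (fun v : P => |vert (i * theta n) ((v : Plane) - u)|) _ ⟨w, huw, hw⟩
  have hle : ∀ z : P, (vis S).Adj u z → (z : Plane) ∈ C →
      |vert (i * theta n) ((v : Plane) - u)| ≤ |vert (i * theta n) ((z : Plane) - u)| := by
    intro z hz hzC
    rcases le_total |vert (i * theta n) ((v : Plane) - u)|
      |vert (i * theta n) ((z : Plane) - u)| with h | h
    · exact h
    · exact hmin ⟨hz, hzC⟩ h
  refine ⟨v, hv, hvC, Or.inl ⟨hv, i, C, hC, hvC, fun z hz hzC => ?_⟩, hle⟩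
  rw [dist_bisectorProj, dist_bisectorProj]
  exact hle z hz hzC

/-- This is where `k ≥ 1` enters: with five cones there would be equality, and the denominator of
`horFactor` would vanish. -/
theorem five_mul_theta_lt {k : ℕ} (hk : 1 ≤ k) : 5 * theta (4 * k + 5) < 2 * Real.pi := by
  have h0 := theta_pos (n := 4 * k + 5) (by omega)
  rw [← mul_theta (n := 4 * k + 5) (by omega)]
  refine mul_lt_mul_of_pos_right ?_ h0
  exact_mod_cast (by omega : 5 < 4 * k + 5)

/-- The induction step: if the bound holds for all pairs of smaller weight, then it holds for `u` and
`w`. -/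
theorem exists_walk_of_smaller {k : ℕ} (hk : 1 ≤ k) {P : Finset Plane}
    (hP : GeneralPosition (4 * k + 5) P) {S : SimpleGraph P} (hS : PlanarConstraints S)
    {u w : P} {i : Fin (4 * k + 5)} (huw : (vis S).Adj u w)
    (hw : (w : Plane) ∈ cone (4 * k + 5) u i)
    (ih : ∀ (p q : P) (j : Fin (4 * k + 5)), weight (4 * k + 5) j ((q : Plane) - p) <
      weight (4 * k + 5) i ((w : Plane) - u) → (vis S).Adj p q →
      (q : Plane) ∈ cone (4 * k + 5) p j → ∃ W : (thetaGraph (4 * k + 5) S).Walk p q,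
        walkLength W ≤ weight (4 * k + 5) j ((q : Plane) - p)) :
    ∃ W : (thetaGraph (4 * k + 5) S).Walk u w,
      walkLength W ≤ weight (4 * k + 5) i ((w : Plane) - u) := by
  have hn : 5 ≤ 4 * k + 5 := by omega
  obtain ⟨C, hC, hwC⟩ := exists_isSubcone hn hP S huw.1 hw
  obtain ⟨v, huv, hvC, hadj, hmin⟩ := exists_closest S huw i hC hwC
  have h5 := five_mul_theta_lt hk
  have h0 := theta_pos hn
  have hcos := cos_half_theta_pos hn
  have hτ := tan_half_theta_pos hn
  have hA := vertFactor_pos h0 h5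
  have hc := horFactor_pos h0 h5
  have hAdef : vertFactor (theta (4 * k + 5)) = 1 / Real.cos (theta (4 * k + 5) / 2) +
    horFactor (theta (4 * k + 5)) * Real.tan (theta (4 * k + 5) / 2) := rfl
  set V := vert (i * theta (4 * k + 5)) with hV
  set H := hor (i * theta (4 * k + 5)) with hH
  set τ := Real.tan (theta (4 * k + 5) / 2) with hτdef
  set A := vertFactor (theta (4 * k + 5)) with hAd
  set c := horFactor (theta (4 * k + 5)) with hcd
  have hweight : ∀ d, weight (4 * k + 5) i d = A * V d + c * |H d| := fun _ => rfl
  have hcone : ∀ z ∈ C, |H (z - u)| ≤ τ * V (z - u) := fun z hz =>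
    (mem_cone_iff hn).1 (hC.subset_cone hz)
  have hVpos : ∀ z ∈ C, z ≠ u → 0 < V (z - u) := fun z hz hzu =>
    vert_pos_of_abs_hor_le hτ (sub_ne_zero.2 hzu) (hcone z hz)
  have hvu : (v : Plane) ≠ u := Subtype.coe_injective.ne huv.1.symm
  have hwu : (w : Plane) ≠ u := Subtype.coe_injective.ne huw.1.symm
  have hVv := hVpos v hvC hvu
  have hVw := hVpos w hwC hwu
  have hAV : ∀ x : ℝ, A * x = x / Real.cos (theta (4 * k + 5) / 2) + c * (τ * x) := by
    intro x
    rw [hAdef]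
    ring
  have hlen : dist (u : Plane) (v : Plane) ≤
      V ((v : Plane) - u) / Real.cos (theta (4 * k + 5) / 2) := by
    rw [dist_comm, dist_eq_norm]
    exact norm_le_of_abs_hor_le hcos hVv.le (hcone v hvC)
  have hcτ : c * |H ((v : Plane) - u)| ≤ c * (τ * V ((v : Plane) - u)) :=
    mul_le_mul_of_nonneg_left (hcone v hvC) hc.le
  by_cases hvw : v = w
  · subst hvw
    refine ⟨hadj.toWalk, ?_⟩
    rw [walkLength_toWalk, hweight, hAV]
    have := mul_nonneg hc.le (abs_nonneg (H ((v : Plane) - u)))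
    linarith
  have hD := hP.cross_ne_zero huw.1 (Ne.symm hvw) huv.1
  -- the sign that makes `v` lie to the left of `u w`
  obtain ⟨σ, hσ, hσD⟩ : ∃ σ : ℝ, (σ = 1 ∨ σ = -1) ∧
      0 < σ * cross ((w : Plane) - u) ((v : Plane) - u) := by
    rcases lt_or_gt_of_ne hD with h | h
    · exact ⟨-1, Or.inr rfl, by linarith⟩
    · exact ⟨1, Or.inl rfl, by linarith⟩
  rw [← hor_mul_vert_sub (i * theta (4 * k + 5)), ← hV, ← hH] at hσD
  set X : Plane →ₗ[ℝ] ℝ := σ • H with hX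
  have hXapp : ∀ d, X d = σ * H d := fun _ => rfl
  have hXabs : ∀ d, |X d| = |H d| := by
    intro d
    rw [hXapp, abs_mul]
    rcases hσ with rfl | rfl <;> simp
  have hDX : 0 < X ((w : Plane) - u) * V ((v : Plane) - u) -
      V ((w : Plane) - u) * X ((v : Plane) - u) := by
    rw [hXapp, hXapp]
    linarith
  have hsub : ∀ (l : Plane →ₗ[ℝ] ℝ) (a b : Plane), l (a - b) = l (a - u) - l (b - u) := by
    intro l a b
    rw [← map_sub]
    congr 1
    module
  have hQC : ∀ z ∈ otherVertices P u v w, z ∈ C := by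
    obtain ⟨d, -, e, -, -, -, rfl⟩ := hC
    exact fun z hz => triangle_subset_sector hvC hwC hz.2.2
  have hwQ : (w : Plane) ∈ otherVertices P u v w := ⟨w.2, hwu, right_mem_triangle _ _ _⟩
  -- The lowest vertex of the triangle is visible from `u` and in the same subcone, so the choice of
  -- `v` makes `v` at least as low.
  have hlow : ∀ z ∈ otherVertices P u v w, V ((v : Plane) - u) ≤ V (z - u) := by
    obtain ⟨q, hq, hqmin⟩ := Set.exists_min_image _ (fun z => V z)
      (otherVertices_finite P u v w) ⟨w, hwQ⟩
    have hqu := hVpos q (hQC q hq) hq.2.1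
    have huq : (vis S).Adj u ⟨q, hq.1⟩ := by
      refine vis_of_forall_le hP hS huv huw hvw hq V ?_ hqmin
      rw [map_sub] at hqu
      change V u < V q
      linarith
    have hvq := hmin ⟨q, hq.1⟩ huq (hQC q hq)
    rw [abs_of_pos hVv, abs_of_pos hqu] at hvq
    intro z hz
    have := hqmin z hz
    refine hvq.trans ?_
    rw [map_sub, map_sub]
    linarith
  -- With this bound `2 * M - X (w - u)` is `|H (w - u)|`: a curve from the bisector to `M` and back
  -- to `w` has no superfluous variation.
  set M := max 0 (X ((w : Plane) - u)) with hM
  have hXvM : X ((v : Plane) - u) ≤ M := by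
    rcases le_total 0 (X ((w : Plane) - u)) with h | h
    · refine le_trans ?_ (le_max_right _ _)
      have := hlow w hwQ
      by_contra! hcon
      nlinarith
    · refine le_trans ?_ (le_max_left _ _)
      by_contra! hcon
      nlinarith
  have hXM : ∀ z ∈ otherVertices P u v w, X (z - u) ≤ M := by
    rintro z ⟨-, -, s, t, hs, ht, hst, rfl⟩
    have e : (u : Plane) + s • ((v : Plane) - u) + t • ((w : Plane) - u) - u =
        s • ((v : Plane) - u) + t • ((w : Plane) - u) := by module
    rw [e, map_add, map_smul, map_smul, smul_eq_mul, smul_eq_mul]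
    have h1 := mul_le_mul_of_nonneg_left hXvM hs
    have h2 := mul_le_mul_of_nonneg_left (le_max_right 0 (X ((w : Plane) - u))) ht
    have h3 := mul_le_mul_of_nonneg_right hst (le_max_left 0 (X ((w : Plane) - u)))
    rw [← hM] at h2 h3
    linarith
  have hMabs : 2 * M - X ((w : Plane) - u) = |H ((w : Plane) - u)| := by
    rw [← hXabs, hM]
    rcases le_total 0 (X ((w : Plane) - u)) with h | h
    · rw [max_eq_right h, abs_of_nonneg h]
      ring
    · rw [max_eq_left h, abs_of_nonpos h]
      ring
  have hXv : c * -X ((v : Plane) - u) ≤ c * (τ * V ((v : Plane) - u)) := by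
    refine mul_le_mul_of_nonneg_left ?_ hc.le
    refine (neg_le_abs _).trans ?_
    rw [hXabs]
    exact hcone v hvC
  -- The saving `A * V (v - u)` covers the length bound of the edge `uv` and the horizontal offset
  -- of `v`.
  have hsum : A * V ((w : Plane) - v) +
      c * (2 * M - X ((v : Plane) - u) - X ((w : Plane) - u)) ≤
      weight (4 * k + 5) i ((w : Plane) - u) -
        V ((v : Plane) - u) / Real.cos (theta (4 * k + 5) / 2) := by
    have e1 : 2 * M - X ((v : Plane) - u) - X ((w : Plane) - u) =
        |H ((w : Plane) - u)| + -X ((v : Plane) - u) := by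
      rw [← hMabs]
      ring
    have e2 := hAV (V ((v : Plane) - u))
    rw [e1, mul_add, hweight, hsub V w v, mul_sub]
    linarith
  have hpos : 0 < V ((v : Plane) - u) / Real.cos (theta (4 * k + 5) / 2) := div_pos hVv hcos
  obtain ⟨W, hW⟩ := exists_walk_along_chain hP hS (G := thetaGraph (4 * k + 5) S) huw X V
    (τ := τ) (A := A) (c := c) (K := weight (4 * k + 5) i ((w : Plane) - u)) hA.le hc.le (by
      intro p q hpq hVe hXe hlt
      rw [hXabs] at hXe hlt ⊢
      obtain ⟨j, hj, hjw⟩ := exists_cone_weight_le hk i hσ hVe hXe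
      obtain ⟨W, hW⟩ := ih p q j (lt_of_le_of_lt hjw hlt) hpq ((mem_cone_iff hn).2 hj)
      exact ⟨W, hW.trans hjw⟩)
    hVw (by rw [hXabs]; exact hcone w hwC) _ v M le_rfl huv hvw hVv
    (by rw [hXabs]; exact hcone v hvC) hDX
    (fun b hub s t hs ht => hC.not_adj hvC hwC
      (hP.cross_ne_zero huv.1 hvw huw.1) hub hs ht)
    (fun z hz => ⟨hlow z hz, hXM z hz⟩) (by linarith)
  refine ⟨SimpleGraph.Walk.cons hadj W, ?_⟩
  rw [walkLength_cons]
  linarith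

/-- Two vertices that see each other are connected by a walk whose length is bounded by the weight of
their difference. -/
theorem exists_walk_le_weight {k : ℕ} (hk : 1 ≤ k) {P : Finset Plane}
    (hP : GeneralPosition (4 * k + 5) P) {S : SimpleGraph P} (hS : PlanarConstraints S)
    (u w : P) (i : Fin (4 * k + 5)) (huw : (vis S).Adj u w)
    (hw : (w : Plane) ∈ cone (4 * k + 5) u i) :
    ∃ W : (thetaGraph (4 * k + 5) S).Walk u w,
      walkLength W ≤ weight (4 * k + 5) i ((w : Plane) - u) := by
  let f : P × P × Fin (4 * k + 5) → ℝ := fun x => weight (4 * k + 5) x.2.2 ((x.2.1 : Plane) - x.1)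
  -- The weights are real, but comparing them is well-founded on the finite set of triples.
  let r : P × P × Fin (4 * k + 5) → P × P × Fin (4 * k + 5) → Prop := fun x y => f x < f y
  have : IsTrans _ r := ⟨fun _ _ _ h h' => lt_trans h h'⟩
  have : Std.Irrefl r := ⟨fun _ => lt_irrefl _⟩
  have hwf : WellFounded r := Finite.wellFounded_of_trans_of_irrefl r
  suffices h : ∀ x : P × P × Fin (4 * k + 5), (vis S).Adj x.1 x.2.1 →
      (x.2.1 : Plane) ∈ cone (4 * k + 5) x.1 x.2.2 →
      ∃ W : (thetaGraph (4 * k + 5) S).Walk x.1 x.2.1, walkLength W ≤ f x from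
    h (u, w, i) huw hw
  intro x
  induction x using hwf.induction with
  | _ x ih =>
    intro hx hcone
    exact exists_walk_of_smaller hk hP hS hx hcone
      fun p q j hlt hpq hq => ih (p, q, j) hlt hpq hq

/-! ### From the weight to the angle α -/

theorem canonicalMidpoint_sub {n : ℕ} (hn : 5 ≤ n) (u w : Plane) (i : Fin n) :
    canonicalMidpoint n u w i - u = vert (i * theta n) (w - u) • dir (i * theta n) := by
  have hc := (cos_half_theta_pos hn).ne'
  rw [canonicalMidpoint, corner, corner, bisector, inner_dir, inner_dir, inner_dir, vert_leftRay,
    vert_rightRay, midpoint_eq_smul_add]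
  set V := vert (i * theta n) (w - u)
  have e : (⅟2 : ℝ) • (u + (V / Real.cos (theta n / 2)) • leftRay n i +
      (u + (V / Real.cos (theta n / 2)) • rightRay n i)) - u =
      (V / (2 * Real.cos (theta n / 2))) • (leftRay n i + rightRay n i) := by
    rw [invOf_eq_inv]
    have : V / (2 * Real.cos (theta n / 2)) = 2⁻¹ * (V / Real.cos (theta n / 2)) := by
      field_simp
    rw [this]
    module
  rw [e]
  apply ext_hor_vert (i * theta n)
  · rw [map_smul, map_smul, map_add, hor_leftRay, hor_rightRay, hor_dir]
    simp
  · rw [map_smul, map_smul, map_add, vert_leftRay, vert_rightRay, vert_dir]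
    simp only [sub_self, Real.cos_zero, smul_eq_mul]
    field_simp
    ring

/-- The midpoint is on the bisector, so α is the unsigned angle between `w - u` and the bisector;
this turns the weight into the stated bound. -/
theorem angle_canonicalMidpoint {n : ℕ} (hn : 5 ≤ n) {u w : Plane} (huw : w ≠ u) {i : Fin n}
    (hw : w ∈ cone n u i) {α : ℝ}
    (hα : α = EuclideanGeometry.angle w u (canonicalMidpoint n u w i)) :
    Real.cos α * dist u w = vert (i * theta n) (w - u) ∧
      Real.sin α * dist u w = |hor (i * theta n) (w - u)| := by
  have hV := vert_pos_of_abs_hor_le (tan_half_theta_pos hn) (sub_ne_zero.2 huw)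
    ((mem_cone_iff hn).1 hw)
  have hang : α = InnerProductGeometry.angle (w - u) (dir (i * theta n)) := by
    rw [hα, EuclideanGeometry.angle, vsub_eq_sub, vsub_eq_sub, canonicalMidpoint_sub hn,
      InnerProductGeometry.angle_smul_right_of_pos _ _ hV]
  have hnorm : dist u w = ‖w - u‖ := by rw [dist_comm, dist_eq_norm]
  have hcos : Real.cos α * dist u w = vert (i * theta n) (w - u) := by
    have := InnerProductGeometry.cos_angle_mul_norm_mul_norm (w - u) (dir (i * theta n))
    rwa [norm_dir, mul_one, inner_dir, ← hang, ← hnorm] at this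
  refine ⟨hcos, ?_⟩
  have hs : 0 ≤ Real.sin α := by
    rw [hang]
    exact InnerProductGeometry.sin_angle_nonneg _ _
  rw [← abs_of_nonneg (mul_nonneg hs dist_nonneg), ← sq_eq_sq_iff_abs_eq_abs]
  have h := hor_sq_add_vert_sq (i * theta n) (w - u)
  rw [← hcos, ← hnorm] at h
  linear_combination dist u w ^ 2 * Real.sin_sq_add_cos_sq α - h

end ConstrainedTheta

theorem mainTheorem8 (k : ℕ) (hk : 1 ≤ k) (P : Finset ConstrainedTheta.Plane)
    (hP : ConstrainedTheta.GeneralPosition (4 * k + 5) P)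
    (S : SimpleGraph P) (hS : ConstrainedTheta.PlanarConstraints S)
    (u w : P) (huw : (ConstrainedTheta.vis S).Adj u w)
    (i : Fin (4 * k + 5))
    (hw : (w : ConstrainedTheta.Plane) ∈ ConstrainedTheta.cone (4 * k + 5) u i)
    (θ α : ℝ) (hθ : θ = 2 * Real.pi / ((4 * k + 5 : ℕ) : ℝ))
    (hα : α = EuclideanGeometry.angle (w : ConstrainedTheta.Plane) (u : ConstrainedTheta.Plane)
      (ConstrainedTheta.canonicalMidpoint (4 * k + 5) u w i)) :
    ∃ p : (ConstrainedTheta.thetaGraph (4 * k + 5) S).Walk u w, p.IsPath ∧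
      ConstrainedTheta.walkLength p ≤
        (Real.cos α / Real.cos (θ / 2) +
          ((Real.cos α * Real.tan (θ / 2) + Real.sin α) * Real.cos (θ / 4)) /
            (Real.cos (θ / 2) - Real.sin (3 * θ / 4))) *
          dist (u : ConstrainedTheta.Plane) (w : ConstrainedTheta.Plane) := by
  obtain ⟨W, hW⟩ := ConstrainedTheta.exists_walk_le_weight hk hP hS u w i huw hw
  obtain ⟨p, hp, hpW⟩ := ConstrainedTheta.exists_isPath_walkLength_le W
  refine ⟨p, hp, hpW.trans (hW.trans (le_of_eq ?_))⟩
  obtain ⟨hc, hs⟩ := ConstrainedTheta.angle_canonicalMidpoint (by omega)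
    (Subtype.coe_injective.ne huw.1.symm) hw hα
  have hθ' : ConstrainedTheta.theta (4 * k + 5) = θ := hθ.symm
  rw [ConstrainedTheta.weight, ← hc, ← hs, hθ', ConstrainedTheta.vertFactor,
    ConstrainedTheta.horFactor]
  ring
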